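/- **Theorem (Monotonicity implies schedulability).** *System.* Fix a set of events, a set of locations and a lattice of security labels ($\ell\sqsubseteq\ell'$: information may flow from $\ell$ to $\ell'$). Every event has a location and a label, and every location has a set of labels permitted there. Every event belongs to a run of a piece of code, which is named by its start event. A strict partial order (happens-before) is given on events, to be used between events of the same run. A symmetric relation says which events conflict; conflicting events have the same label and the same location, and start events, being external inputs, conflict with nothing. Some events are the receipt of a message sent by another event. A *transaction* is a finite set of events of one run which contains its start event, whose other events all happen after the start event, whose labels are permitted at their locations, and which contains, for every message receipt in it, the earlier send event. Several transactions may have the same start event. A transaction is *secure* if $e_1\to e_2$ implies $\ell(e_1)\sqsubseteq\ell(e_2)$ for its events, and *monotonic* if it is secure and its events are totally ordered by happens-before. *Protocols and executions.* A protocol may add events on behalf of runs: sending and receiving the $k$-th message on a channel (given by source, destination, label of the receipt, and run), and lock events. For every receive event there is a network delay event with the same label and location, which identifies the channel and the number of the message but not its contents. A state is a set of events. A location's view of a state consists of the events at that location and of the send events of the messages that the network has delivered there. A *protocol* is a function that maps a set $\mathcal T$ of possible transactions, a location and that location's view of the state to at most one event. Start events of members of $\mathcal T$ and network delay events of messages that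 have been sent are *nondeterministic input events* (NIEs); each may occur, once, at any time (a delay event: at any time after its send event). An execution is a start state followed by a finite sequence of distinct new events; it is consistent with a protocol if each of its events is an NIE that can occur or the result of the protocol at the event's location on that location's view of the preceding state. A full execution starts from the empty state. *Happens-before* in an execution is the transitive closure of: earlier events before later ones where both belong to the same run and are so ordered by its code, or conflict, or belong to the same lock, or belong to the same run at the same location and at least one of them was added by the protocol; and send event before delay event before receive event of a message. Transaction $T_2$ directly depends on $T_1\ne T_2$ if an event of $T_1$ happens before an event of $T_2$. A full execution is *serializable* if the transitive closure of direct dependence is a strict partial order on its transactions. *Claim.* There is a protocol $p$ such that, for every set $\mathcal T$ of monotonic transactions: 1. ($p$ serializes $\mathcal T$.) (a) In every full execution consistent with $p$, every event scheduled by $p$ is legal. A transaction event belongs to some $T\in\mathcal T$ that contains all events scheduled so far for its run; all events of $T$ that happen before it have been scheduled, no event that happens after it has been, and its network delay event has occurred if it is a message receipt. A message receipt follows its delay event and has the contents that were sent. All other events are added on behalf of started runs, with permitted labels, only at (and with messages only to) locations of events of started possible transactions; the messages on a channel are sent in order of their numbers, each once. (b) Every full execution consistent with $p$ is serializable. (c)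 (Deadlock freedom.) Every full execution consistent with $p$ can be extended, consistently with $p$ and without further start events, so that for every start event $s$ that had occurred, the events of its run are exactly those of some $T\in\mathcal T$ with start event $s$. 2. ($p$ preserves relaxed observational determinism.) Let $\ell$ be a label and call an event visible if its label is $\sqsubseteq\ell$. Let $E,E'$ be executions consistent with $p$ whose (arbitrary finite) start states have the same visible events, and suppose that at each location the same visible NIEs occur in $E$ and in $E'$, each at the same point, i.e. with the same set of visible events at that location before it. Then $E$ and $E'$ are indistinguishable at level $\ell$: at every location, the sequence of visible events of one of them is a prefix of that of the other; and if $p$ has nothing left to schedule at that location at the end of one of the two executions, then the visible sequence of the other one there is a prefix of its own (so they are equal if this holds for both). -/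

import Mathlib

universe u v w

namespace SecureScheduling

/-- The static data of a distributed transaction system: its native events, the locations at
which they happen, and their security labels, drawn from a lattice (`a ≤ b` means that
information may flow from `a` to `b`). -/
structure System (Ev : Type u) (Loc : Type v) (Lab : Type w) [Lattice Lab] where
  /-- location of an event -/
  loc : Ev → Loc
  /-- security label of an event -/
  label : Ev → Lab
  /-- the labels that a location may be trusted with -/
  permitted : Loc → Set Lab
  /-- the start event of the run of code that an event arises from; start events are the
  fixed points -/
  startOf : Ev → Ev
  /-- happens-before between the events of one run of a piece of code -/
  before : Ev → Ev → Prop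
  before_irrefl : ∀ a, ¬ before a a
  before_trans : ∀ a b c, before a b → before b c → before a c
  /-- conflicting events, which have to be ordered for data to be consistent -/
  conflict : Ev → Ev → Prop
  conflict_symm : ∀ a b, conflict a b → conflict b a
  conflict_label : ∀ a b, conflict a b → label a = label b
  conflict_loc : ∀ a b, conflict a b → loc a = loc b
  /-- start events are external inputs, and conflict with nothing -/
  conflict_not_start : ∀ a b, conflict a b → startOf a ≠ a
  /-- `sendOf r = some a`: the event `r` is the receipt of the message sent by `a` -/
  sendOf : Ev → Option Ev

variable {Ev : Type u} {Loc : Type v} {Lab : Type w} [Lattice Lab]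

/-- A possible transaction: a finite set of events that can arise from running a piece of code,
with a start event that happens before all the others. -/
structure Transaction (Sys : System Ev Loc Lab) where
  events : Finset Ev
  start : Ev
  start_mem : start ∈ events
  startOf_eq : ∀ e ∈ events, Sys.startOf e = start
  start_before : ∀ e ∈ events, e ≠ start → Sys.before start e
  label_permitted : ∀ e ∈ events, Sys.label e ∈ Sys.permitted (Sys.loc e)
  sendOf_mem : ∀ r ∈ events, ∀ a, Sys.sendOf r = some a → a ∈ events ∧ Sys.before a r

/-- Information flow security of a single transaction. -/
def Transaction.Secure {Sys : System Ev Loc Lab} (T : Transaction Sys) : Prop :=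
  ∀ a ∈ T.events, ∀ b ∈ T.events, Sys.before a b → Sys.label a ≤ Sys.label b

/-- A transaction is monotonic if it is secure and its events are totally ordered by
happens-before. -/
def Transaction.Monotonic {Sys : System Ev Loc Lab} (T : Transaction Sys) : Prop :=
  T.Secure ∧ ∀ a ∈ T.events, ∀ b ∈ T.events, a ≠ b → Sys.before a b ∨ Sys.before b a

/-- A channel for the messages that a protocol sends on behalf of the run started by `run`. -/
structure Channel (Ev : Type u) (Loc : Type v) (Lab : Type w) where
  src : Loc
  dst : Loc
  /-- label of the receive events -/
  label : Lab
  run : Ev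

/-- The events that occur in executions: transaction events, and the events added by the network
and by a scheduling protocol. -/
inductive Event (Ev : Type u) (Loc : Type v) (Lab : Type w) (Body : Type u) : Type (max u v w)
  /-- a native event of the system -/
  | tx (e : Ev)
  /-- the network delay event for the receive event `r` of a transaction -/
  | txDelay (r : Ev)
  /-- the protocol sends the `k`-th message on the channel `c`; `l` is the label of this event -/
  | send (c : Channel Ev Loc Lab) (k : ℕ) (l : Lab) (body : Body)
  /-- the network delay event for the `k`-th message on `c`; it does not tell the contents -/
  | delay (c : Channel Ev Loc Lab) (k : ℕ)
  /-- receipt of the `k`-th message on `c` -/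
  | recv (c : Channel Ev Loc Lab) (k : ℕ) (body : Body)
  /-- the `k`-th event that the run `s` has in the lock for the label `l` at `x` -/
  | sync (s : Ev) (x : Loc) (l : Lab) (k : ℕ)

variable {Body : Type u}

namespace Event

/-- Location of an event. -/
def loc (Sys : System Ev Loc Lab) : Event Ev Loc Lab Body → Loc
  | tx e => Sys.loc e
  | txDelay r => Sys.loc r
  | send c _ _ _ => c.src
  | delay c _ => c.dst
  | recv c _ _ => c.dst
  | sync _ x _ _ => x

/-- Security label of an event. -/
def label (Sys : System Ev Loc Lab) : Event Ev Loc Lab Body → Lab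
  | tx e => Sys.label e
  | txDelay r => Sys.label r
  | send _ _ l _ => l
  | delay c _ => c.label
  | recv c _ _ => c.label
  | sync _ _ l _ => l

/-- The run of code (named by its start event) on whose behalf an event takes place. -/
def run (Sys : System Ev Loc Lab) : Event Ev Loc Lab Body → Ev
  | tx e => Sys.startOf e
  | txDelay r => Sys.startOf r
  | send c _ _ _ => c.run
  | delay c _ => c.run
  | recv c _ _ => c.run
  | sync s _ _ _ => s

/-- Nondeterministic input events: start events and network delay events. -/
def IsNIE (Sys : System Ev Loc Lab) : Event Ev Loc Lab Body → Prop
  | tx e => Sys.startOf e = e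
  | txDelay _ => True
  | delay _ _ => True
  | _ => False

/-- The events that only a protocol adds. -/
def IsProtocolEvent : Event Ev Loc Lab Body → Prop
  | send _ _ _ _ => True
  | recv _ _ _ => True
  | sync _ _ _ _ => True
  | _ => False

/-- Direct causality: if `x` occurs before `y` and this relation holds, then `x` happens
before `y`. -/
inductive Direct (Sys : System Ev Loc Lab) : Event Ev Loc Lab Body → Event Ev Loc Lab Body → Prop
  | code (a b : Ev) : Sys.startOf a = Sys.startOf b → Sys.before a b → Direct Sys (tx a) (tx b)
  | conflict (a b : Ev) : Sys.conflict a b → Direct Sys (tx a) (tx b)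
  | txSend (a r : Ev) : Sys.sendOf r = some a → Direct Sys (tx a) (txDelay r)
  | txReceive (r : Ev) : Direct Sys (txDelay r) (tx r)
  | send (c : Channel Ev Loc Lab) (k : ℕ) (l : Lab) (b : Body) :
      Direct Sys (send c k l b) (delay c k)
  | receive (c : Channel Ev Loc Lab) (k : ℕ) (b : Body) : Direct Sys (delay c k) (recv c k b)
  /-- any two events of the same lock conflict -/
  | lock (s s' : Ev) (x : Loc) (l : Lab) (k k' : ℕ) :
      Direct Sys (sync s x l k) (sync s' x l k')
  /-- what a protocol does for a run at a location is ordered with the other events of that run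
  at that location -/
  | thread (x y : Event Ev Loc Lab Body) : x.loc Sys = y.loc Sys → x.run Sys = y.run Sys →
      x.IsProtocolEvent ∨ y.IsProtocolEvent → Direct Sys x y

end Event

/-- A system state, as the set of events that have been scheduled. -/
abbrev State (Ev : Type u) (Loc : Type v) (Lab : Type w) (Body : Type u) :=
  Set (Event Ev Loc Lab Body)

/-- What a location knows of a state: the events at this location, together with the send events
of the messages that the network has delivered there. -/
def State.localView (Sys : System Ev Loc Lab) (S : State Ev Loc Lab Body) (x : Loc) :
    State Ev Loc Lab Body :=
  {e ∈ S | e.loc Sys = x ∨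
    ∃ c k l b, e = .send c k l b ∧ c.dst = x ∧ Event.delay c k ∈ S}

/-- What an observer at level `l` sees of the events at location `x`. -/
def State.visible (Sys : System Ev Loc Lab) (l : Lab) (x : Loc) (S : State Ev Loc Lab Body) :
    State Ev Loc Lab Body :=
  {e ∈ S | e.loc Sys = x ∧ e.label Sys ≤ l}

/-- A scheduling protocol: given the set of possible transactions, a location, and the state at
that location, it decides which event the location schedules next (if any). -/
abbrev Protocol (Sys : System Ev Loc Lab) (Body : Type u) :=
  Set (Transaction Sys) → Loc → State Ev Loc Lab Body → Option (Event Ev Loc Lab Body)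

/-- An execution: a start state and the sequence of the events that occur after it. -/
structure Execution (Ev : Type u) (Loc : Type v) (Lab : Type w) (Body : Type u) where
  start : State Ev Loc Lab Body
  steps : List (Event Ev Loc Lab Body)

/-- The state after the events `E` have been scheduled from `S`. -/
def State.after (S : State Ev Loc Lab Body) (E : List (Event Ev Loc Lab Body)) :
    State Ev Loc Lab Body :=
  S ∪ {e | e ∈ E}

/-- The final state of an execution. -/
def Execution.final (E : Execution Ev Loc Lab Body) : State Ev Loc Lab Body :=
  E.start.after E.steps

/-- The nondeterministic input events that can occur in the state `S`: the start event of any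
possible transaction, and the network delay event of any message that has been sent. -/
def CanOccur {Sys : System Ev Loc Lab} (TS : Set (Transaction Sys)) (S : State Ev Loc Lab Body) :
    Event Ev Loc Lab Body → Prop
  | .tx e => ∃ T ∈ TS, T.start = e
  | .txDelay r => (∃ T ∈ TS, r ∈ T.events) ∧ ∃ a, Sys.sendOf r = some a ∧ Event.tx a ∈ S
  | .delay c k => ∃ l b, Event.send c k l b ∈ S
  | _ => False

/-- In the state `S`, the protocol schedules the event `e` next at the location of `e`. -/
def Schedules {Sys : System Ev Loc Lab} (p : Protocol Sys Body) (TS : Set (Transaction Sys))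
    (S : State Ev Loc Lab Body) (e : Event Ev Loc Lab Body) : Prop :=
  ¬ e.IsNIE Sys ∧ e ∉ S ∧ p TS (e.loc Sys) (S.localView Sys (e.loc Sys)) = some e

/-- `e` can be the next event of an execution consistent with `p`: it is a nondeterministic
input event, or the result of `p` on the previous state at the location of `e`. -/
def Step {Sys : System Ev Loc Lab} (p : Protocol Sys Body) (TS : Set (Transaction Sys))
    (S : State Ev Loc Lab Body) (e : Event Ev Loc Lab Body) : Prop :=
  (e ∉ S ∧ CanOccur TS S e) ∨ Schedules p TS S e

/-- The execution is consistent with the protocol `p`. -/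
def Consistent {Sys : System Ev Loc Lab} (p : Protocol Sys Body) (TS : Set (Transaction Sys))
    (E : Execution Ev Loc Lab Body) : Prop :=
  ∀ E₁ e E₂, E.steps = E₁ ++ e :: E₂ → Step p TS (E.start.after E₁) e

/-- `E` is the sequence of events of a full execution consistent with `p`. -/
def FullConsistent {Sys : System Ev Loc Lab} (p : Protocol Sys Body) (TS : Set (Transaction Sys))
    (E : List (Event Ev Loc Lab Body)) : Prop :=
  Consistent p TS ⟨∅, E⟩

/-- `x` is the location of an event of a possible transaction that has been started; there are
no third parties. -/
def Participant {Sys : System Ev Loc Lab} (TS : Set (Transaction Sys)) (S : State Ev Loc Lab Body)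
    (x : Loc) : Prop :=
  ∃ T ∈ TS, Event.tx T.start ∈ S ∧ ∃ e ∈ T.events, Sys.loc e = x

/-- The events that a protocol may legitimately schedule in the (global) state `S`. -/
def Legal {Sys : System Ev Loc Lab} (TS : Set (Transaction Sys)) (S : State Ev Loc Lab Body) :
    Event Ev Loc Lab Body → Prop
  -- the next event of a started transaction, in an order consistent with happens-before,
  -- and after its network delay event if it is the receipt of a message
  | .tx e => Sys.startOf e ≠ e ∧ ∃ T ∈ TS, e ∈ T.events ∧
      (∀ a, Event.tx a ∈ S → Sys.startOf a = Sys.startOf e → a ∈ T.events ∧ ¬ Sys.before e a) ∧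
      (∀ a ∈ T.events, Sys.before a e → Event.tx a ∈ S) ∧
      (∀ a, Sys.sendOf e = some a → Event.txDelay e ∈ S)
  -- the next message on a channel, on behalf of a started transaction
  | .send c k l _ => Event.tx c.run ∈ S ∧ Participant TS S c.src ∧ Participant TS S c.dst ∧
      l ∈ Sys.permitted c.src ∧ c.label ∈ Sys.permitted c.dst ∧
      (∀ j < k, ∃ l' b', Event.send c j l' b' ∈ S) ∧ ∀ l' b', Event.send c k l' b' ∉ S
  -- a message that has been sent and delivered
  | .recv c k b => Event.delay c k ∈ S ∧ ∃ l, Event.send c k l b ∈ S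
  | .sync s x l _ => Event.tx s ∈ S ∧ Participant TS S x ∧ l ∈ Sys.permitted x
  | _ => False

/-- Happens-before on the events of an execution. -/
def HappensBefore (Sys : System Ev Loc Lab) (E : List (Event Ev Loc Lab Body)) :
    Event Ev Loc Lab Body → Event Ev Loc Lab Body → Prop :=
  Relation.TransGen fun x y => [x, y].Sublist E ∧ x.Direct Sys y

/-- Direct dependence between the transactions that run under the start events `s` and `t`:
an event of the first happens before an event of the second. -/
def DependsOn (Sys : System Ev Loc Lab) (E : List (Event Ev Loc Lab Body)) (s t : Ev) : Prop :=
  s ≠ t ∧ ∃ a b, Sys.startOf a = s ∧ Sys.startOf b = t ∧ HappensBefore Sys E (.tx a) (.tx b)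

/-- The transactions of an execution are serializable: happens-before, the transitive closure of
direct dependence, is a strict partial order on them. -/
def Serializable (Sys : System Ev Loc Lab) (E : List (Event Ev Loc Lab Body)) : Prop :=
  IsStrictOrder Ev (Relation.TransGen (DependsOn Sys E))

/-- The events that have occurred under the start event `s` make up a possible transaction. -/
def Completed {Sys : System Ev Loc Lab} (TS : Set (Transaction Sys))
    (E : List (Event Ev Loc Lab Body)) (s : Ev) : Prop :=
  ∃ T ∈ TS, T.start = s ∧ ∀ e, Sys.startOf e = s → (Event.tx e ∈ E ↔ e ∈ T.events)

/-- Everything that the protocol schedules in full executions is legal. -/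
def Sound {Sys : System Ev Loc Lab} (p : Protocol Sys Body) (TS : Set (Transaction Sys)) : Prop :=
  ∀ E e, FullConsistent p TS (E ++ [e]) → ¬ e.IsNIE Sys → Legal TS {e' | e' ∈ E} e

/-- Deadlock freedom: whatever has happened so far, all the transactions that have been started
can still be completed, without any further start event. -/
def DeadlockFree {Sys : System Ev Loc Lab} (p : Protocol Sys Body) (TS : Set (Transaction Sys)) :
    Prop :=
  ∀ E, FullConsistent p TS E → ∃ F, FullConsistent p TS (E ++ F) ∧
    (∀ s, Sys.startOf s = s → Event.tx s ∉ F) ∧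
    ∀ s, Sys.startOf s = s → Event.tx s ∈ E → Completed TS (E ++ F) s

/-- The protocol serializes the transactions `TS`. -/
def Serializes {Sys : System Ev Loc Lab} (p : Protocol Sys Body) (TS : Set (Transaction Sys)) :
    Prop :=
  Sound p TS ∧ (∀ E, FullConsistent p TS E → Serializable Sys E) ∧ DeadlockFree p TS

open Classical in
/-- The sequence of the events at location `x` that an observer at level `l` sees. -/
noncomputable def Execution.trace (Sys : System Ev Loc Lab) (l : Lab) (x : Loc)
    (E : Execution Ev Loc Lab Body) : List (Event Ev Loc Lab Body) :=
  E.steps.filter fun e => decide (e.loc Sys = x ∧ e.label Sys ≤ l)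

/-- The nondeterministic input events of `E` at location `x` that an observer at level `l` sees,
each with the point at which it occurs, that is, what the observer has seen at `x` by then. -/
def Execution.inputs (Sys : System Ev Loc Lab) (l : Lab) (x : Loc)
    (E : Execution Ev Loc Lab Body) : Set (Event Ev Loc Lab Body × State Ev Loc Lab Body) :=
  {q | ∃ E₁ E₂, E.steps = E₁ ++ q.1 :: E₂ ∧ q.1.IsNIE Sys ∧ q.1.loc Sys = x ∧
    q.1.label Sys ≤ l ∧ q.2 = (E.start.after E₁).visible Sys l x}

/-- The protocol has nothing to schedule at the location `x` at the end of `E`. -/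
def Idle {Sys : System Ev Loc Lab} (p : Protocol Sys Body) (TS : Set (Transaction Sys)) (x : Loc)
    (E : Execution Ev Loc Lab Body) : Prop :=
  ∀ e, e.loc Sys = x → ¬ Schedules p TS E.final e

/-- Indistinguishability of executions to an observer at level `l`. Executions may be stopped at
any time, so one of them may lag behind the other at a location, but not if the protocol has
nothing left to schedule there. -/
def Indistinguishable {Sys : System Ev Loc Lab} (p : Protocol Sys Body)
    (TS : Set (Transaction Sys)) (l : Lab) (E E' : Execution Ev Loc Lab Body) : Prop :=
  ∀ x, (E.trace Sys l x <+: E'.trace Sys l x ∨ E'.trace Sys l x <+: E.trace Sys l x) ∧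
    (Idle p TS x E → E'.trace Sys l x <+: E.trace Sys l x) ∧
    (Idle p TS x E' → E.trace Sys l x <+: E'.trace Sys l x)

/-- Relaxed observational determinism: executions with indistinguishable start states and
indistinguishable nondeterministic input events are indistinguishable. -/
def RelaxedObservationalDeterminism {Sys : System Ev Loc Lab} (p : Protocol Sys Body)
    (TS : Set (Transaction Sys)) : Prop :=
  ∀ (l : Lab) (E E' : Execution Ev Loc Lab Body), E.start.Finite → E'.start.Finite →
    Consistent p TS E → Consistent p TS E' →
    (∀ x, E.start.visible Sys l x = E'.start.visible Sys l x) →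
    (∀ x, E.inputs Sys l x = E'.inputs Sys l x) →
    Indistinguishable p TS l E E'

end SecureScheduling

namespace SecureScheduling

variable {Ev : Type u} {Loc : Type v} {Lab : Type w} [Lattice Lab]

/-! The protocol is two-phase locking, with one lock for each pair of a location and a label. For
each start event one possible transaction is fixed in advance. Its plan is the start event, then its
other events, each label's events preceded by the acquisitions of the locks for that label, then all
releases. The phase before the releases is sorted by a linear extension of the flow order, and
within one label by the number of predecessors; for a secure transaction this agrees with
happens-before. A run walks through its plan, and each action is linked to the next by a message
without contents.

Observational determinism: whether an event may be scheduled depends only on events with its own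
location and label (`Candidate.congr`). Of the possible events a location takes the least in a fixed
well-order. If two executions show the same visible past and both schedule a visible event next,
each event is possible in both states, so they coincide (`Schedules.eq_of_visible_eq`). The step
from one label to the next in a plan is made by a network delay event, which is an input and assumed
equal in both executions.

Serializability: events of different runs are directly related only by conflicts and by locks.
Conflicting events share location and label, hence a lock, so one run releases it before the other
acquires it. This gives the relation `Earlier`, which is transitive and irreflexive because a run
makes all its acquisitions before its releases.

Deadlock freedom: every run acquires its locks in increasing `lockKey`. In a stuck state each
unfinished run waits for a lock held by another unfinished run; for a wait on a maximal key the
holder would itself wait for a larger one. Finitely many events complete the started runs, so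
progress ends with all of them done. -/

/-- The position of a lock in the order in which locks are acquired: by label first, in a linear
extension of the flow order. -/
noncomputable def lockKey (x : Loc) (l : Lab) : LinearExtension Lab ×ₗ ℕ ×ₗ Cardinal.{v} :=
  toLex (toLinearExtension l, toLex (0, embeddingToCardinal x))

/-- The `sync` event by which the run `s` acquires the lock for `l` at `x`. -/
abbrev acquire (s : Ev) (x : Loc) (l : Lab) : Event Ev Loc Lab PUnit.{u + 1} := .sync s x l 0

/-- The `sync` event by which the run `s` releases the lock for `l` at `x`. -/
abbrev release (s : Ev) (x : Loc) (l : Lab) : Event Ev Loc Lab PUnit.{u + 1} := .sync s x l 1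

/-! ### Plans of transactions. -/

namespace Transaction

variable {Sys : System Ev Loc Lab}

open Classical in
/-- The number of events of the transaction that happen before `e`. -/
noncomputable def depth (T : Transaction Sys) (e : Ev) : ℕ :=
  (T.events.filter fun a => Sys.before a e).card

/-- The sort key of the actions of a transaction: the locks for a label are acquired right before
the events with that label, and all locks are released at the end. -/
noncomputable def actionKey (T : Transaction Sys) :
    Event Ev Loc Lab PUnit.{u + 1} → ℕ ×ₗ LinearExtension Lab ×ₗ ℕ ×ₗ Cardinal.{v}
  -- The `+ 1` places the event after the acquisitions for its label, whose entry here is `0`; the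
  -- depth orders events of equal label along happens-before.
  | .tx e => toLex (0, toLex (toLinearExtension (Sys.label e), toLex (T.depth e + 1, 0)))
  | .sync _ x l k => toLex (k, lockKey x l)
  -- A default value: no other events are among the actions.
  | e => toLex (0, toLex (toLinearExtension (e.label Sys), toLex (0, 0)))

open Classical in
/-- What the run of a transaction does after its start event, unordered. -/
noncomputable def actions (T : Transaction Sys) : Finset (Event Ev Loc Lab PUnit.{u + 1}) :=
  (T.events.erase T.start).biUnion fun e =>
    {.tx e, acquire T.start (Sys.loc e) (Sys.label e), release T.start (Sys.loc e) (Sys.label e)}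

/-- The sequence of the actions of a transaction. -/
noncomputable def plan (T : Transaction Sys) : List (Event Ev Loc Lab PUnit.{u + 1}) :=
  .tx T.start :: T.actions.toList.mergeSort fun a b => decide (T.actionKey a ≤ T.actionKey b)

end Transaction

/-! ### The protocol, and the locality of its decisions. -/

section Protocol

variable {Sys : System Ev Loc Lab} (TS : Set (Transaction Sys))

open Classical in
/-- The sequence of the actions of the run `s`. -/
noncomputable def runPlan (s : Ev) : List (Event Ev Loc Lab PUnit.{u + 1}) :=
  if h : ∃ T ∈ TS, T.start = s then h.choose.plan else []

/-- The `i`-th action of the run `s`. -/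
noncomputable def action (s : Ev) (i : ℕ) : Event Ev Loc Lab PUnit.{u + 1} :=
  (runPlan TS s).getD i (.tx s)

/-- The channel on which the run `s` is passed on after its `i`-th action. -/
noncomputable def chan (s : Ev) (i : ℕ) : Channel Ev Loc Lab where
  src := (action TS s i).loc Sys
  dst := (action TS s (i + 1)).loc Sys
  -- The delay and the receipt carry the label of the next action, while the sending carries that of
  -- the previous one. Only the delay event, an input, thus links two labels, even where the plan
  -- passes to a lower or incomparable one.
  label := (action TS s (i + 1)).label Sys
  run := s

open Classical in
/-- The number, on its channel, of the message that follows the `i`-th action of the run `s`. -/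
noncomputable def num (s : Ev) (i : ℕ) : ℕ :=
  Nat.count (fun j => chan TS s j = chan TS s i) i

/-- The event that sends the message after the `i`-th action of the run `s`. -/
noncomputable def sendEv (s : Ev) (i : ℕ) : Event Ev Loc Lab PUnit.{u + 1} :=
  .send (chan TS s i) (num TS s i) ((action TS s i).label Sys) ⟨⟩

/-- The network delay event of the message after the `i`-th action of the run `s`. -/
noncomputable def delayEv (s : Ev) (i : ℕ) : Event Ev Loc Lab PUnit.{u + 1} :=
  .delay (chan TS s i) (num TS s i)

/-- The receipt of the message after the `i`-th action of the run `s`. -/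
noncomputable def recvEv (s : Ev) (i : ℕ) : Event Ev Loc Lab PUnit.{u + 1} :=
  .recv (chan TS s i) (num TS s i) ⟨⟩

/-- It is the turn of an event in its run. -/
inductive Triggered (V : State Ev Loc Lab PUnit.{u + 1}) :
    Event Ev Loc Lab PUnit.{u + 1} → Prop
  | send (s : Ev) (i : ℕ) : i + 1 < (runPlan TS s).length → action TS s i ∈ V →
      Triggered V (sendEv TS s i)
  -- The delay event suffices: the contents are trivial, and the send event may have a different
  -- label.
  | recv (s : Ev) (i : ℕ) : i + 1 < (runPlan TS s).length → delayEv TS s i ∈ V →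
      Triggered V (recvEv TS s i)
  | act (s : Ev) (i : ℕ) : i + 1 < (runPlan TS s).length → recvEv TS s i ∈ V →
      Triggered V (action TS s (i + 1))

/-- The conditions that an event has to wait for: messages of the transaction have to be
delivered, and locks have to be free. -/
def Guard (Sys : System Ev Loc Lab) (V : State Ev Loc Lab PUnit.{u + 1})
    (e : Event Ev Loc Lab PUnit.{u + 1}) : Prop :=
  (∀ r a, e = .tx r → Sys.sendOf r = some a → Event.txDelay r ∈ V) ∧
    ∀ s x l, e = acquire s x l → ∀ t, acquire t x l ∈ V → release t x l ∈ V

/-- The events that the location `x` may schedule next. -/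
def Candidate (x : Loc) (V : State Ev Loc Lab PUnit.{u + 1})
    (e : Event Ev Loc Lab PUnit.{u + 1}) : Prop :=
  e.loc Sys = x ∧ ¬ e.IsNIE Sys ∧ e ∉ V ∧ Triggered TS V e ∧ Guard Sys V e

open Classical in
/-- Two-phase locking, in an order of the locks that follows the flow order; each run is passed on
from action to action by messages without contents. -/
noncomputable def lockingProtocol (Sys : System Ev Loc Lab) : Protocol Sys PUnit.{u + 1} :=
  fun TS x V =>
    if h : {e | Candidate TS x V e}.Nonempty then
      some ((IsWellFounded.wf (r := WellOrderingRel)).min {e | Candidate TS x V e} h)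
    else none

variable {TS}

/-- The labels of the messages are chosen so that what triggers an event always has the location and
label of that event. -/
theorem Triggered.congr {V V' : State Ev Loc Lab PUnit.{u + 1}}
    {e : Event Ev Loc Lab PUnit.{u + 1}} (h : Triggered TS V e)
    (hV : ∀ a, a.loc Sys = e.loc Sys → a.label Sys = e.label Sys → a ∈ V → a ∈ V') :
    Triggered TS V' e := by
  cases h with
  | send s i hi h => exact .send s i hi (hV _ rfl rfl h)
  | recv s i hi h => exact .recv s i hi (hV _ rfl rfl h)
  | act s i hi h => exact .act s i hi (hV _ rfl rfl h)

theorem Triggered.mono {V V' : State Ev Loc Lab PUnit.{u + 1}}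
    {e : Event Ev Loc Lab PUnit.{u + 1}} (h : Triggered TS V e) (hV : V ⊆ V') :
    Triggered TS V' e :=
  h.congr fun _ _ _ ha => hV ha

theorem Guard.congr {V V' : State Ev Loc Lab PUnit.{u + 1}}
    {e : Event Ev Loc Lab PUnit.{u + 1}} (h : Guard Sys V e)
    (hV : ∀ a, a.loc Sys = e.loc Sys → a.label Sys = e.label Sys → (a ∈ V ↔ a ∈ V')) :
    Guard Sys V' e := by
  refine ⟨fun r a he hr => ?_, fun s x l he t ht => ?_⟩
  · subst he
    exact (hV (.txDelay r) rfl rfl).1 (h.1 r a rfl hr)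
  · subst he
    exact (hV (release t x l) rfl rfl).1 (h.2 s x l rfl t ((hV (acquire t x l) rfl rfl).2 ht))

/-- The protocol decides on an event by the events with the same location and label only. -/
theorem Candidate.congr {x : Loc} {V V' : State Ev Loc Lab PUnit.{u + 1}}
    {e : Event Ev Loc Lab PUnit.{u + 1}} (h : Candidate TS x V e)
    (hV : ∀ a, a.loc Sys = e.loc Sys → a.label Sys = e.label Sys → (a ∈ V ↔ a ∈ V')) :
    Candidate TS x V' e :=
  ⟨h.1, h.2.1, fun h' => h.2.2.1 ((hV _ rfl rfl).2 h'),
    h.2.2.2.1.congr fun a h₁ h₂ => (hV a h₁ h₂).1, h.2.2.2.2.congr hV⟩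

theorem candidate_localView {x : Loc} {S : State Ev Loc Lab PUnit.{u + 1}}
    {e : Event Ev Loc Lab PUnit.{u + 1}} :
    Candidate TS x (S.localView Sys x) e ↔ Candidate TS x S e := by
  have key : ∀ a : Event Ev Loc Lab PUnit.{u + 1}, a.loc Sys = x →
      (a ∈ S.localView Sys x ↔ a ∈ S) := fun a ha => ⟨fun h => h.1, fun h => ⟨h, .inl ha⟩⟩
  exact ⟨fun h => h.congr fun a h₁ _ => key a (h₁.trans h.1),
    fun h => h.congr fun a h₁ _ => (key a (h₁.trans h.1)).symm⟩

theorem candidate_visible {x : Loc} {l : Lab} {S : State Ev Loc Lab PUnit.{u + 1}}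
    {e : Event Ev Loc Lab PUnit.{u + 1}} (hl : e.label Sys ≤ l) :
    Candidate TS x (S.visible Sys l x) e ↔ Candidate TS x S e := by
  have key : ∀ a : Event Ev Loc Lab PUnit.{u + 1}, a.loc Sys = x →
      a.label Sys = e.label Sys → (a ∈ S.visible Sys l x ↔ a ∈ S) :=
    fun a ha hb => ⟨fun h => h.1, fun h => ⟨h, ha, hb.trans_le hl⟩⟩
  exact ⟨fun h => h.congr fun a h₁ h₂ => key a (h₁.trans h.1) h₂,
    fun h => h.congr fun a h₁ h₂ => (key a (h₁.trans h.1) h₂).symm⟩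

theorem Schedules.candidate {S : State Ev Loc Lab PUnit.{u + 1}}
    {e : Event Ev Loc Lab PUnit.{u + 1}} (h : Schedules (lockingProtocol Sys) TS S e) :
    Candidate TS (e.loc Sys) S e := by
  obtain ⟨-, -, h⟩ := h
  unfold lockingProtocol at h
  split_ifs at h with hne
  rw [← candidate_localView]
  have := WellFounded.min_mem (IsWellFounded.wf (r := WellOrderingRel)) _ hne
  rwa [Option.some.inj h] at this

theorem Schedules.not_rel {S : State Ev Loc Lab PUnit.{u + 1}}
    {e e' : Event Ev Loc Lab PUnit.{u + 1}} (h : Schedules (lockingProtocol Sys) TS S e)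
    (h' : Candidate TS (e.loc Sys) S e') : ¬ WellOrderingRel e' e := by
  obtain ⟨-, -, h⟩ := h
  unfold lockingProtocol at h
  split_ifs at h with hne
  rw [← Option.some.inj h]
  exact WellFounded.not_lt_min (IsWellFounded.wf (r := WellOrderingRel))
    {e' | Candidate TS (e.loc Sys) (S.localView Sys (e.loc Sys)) e'} (candidate_localView.2 h')

theorem Candidate.exists_schedules {x : Loc} {S : State Ev Loc Lab PUnit.{u + 1}}
    {e : Event Ev Loc Lab PUnit.{u + 1}} (h : Candidate TS x S e) :
    ∃ e', e'.loc Sys = x ∧ Schedules (lockingProtocol Sys) TS S e' := by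
  have hne : {e | Candidate TS x (S.localView Sys x) e}.Nonempty := ⟨e, candidate_localView.2 h⟩
  have hm := WellFounded.min_mem (IsWellFounded.wf (r := WellOrderingRel)) _ hne
  have hc := candidate_localView.1 hm
  refine ⟨_, hc.1, hc.2.1, hc.2.2.1, ?_⟩
  rw [hc.1]
  exact dif_pos hne

/-- Either choice is a candidate in the other state too, so neither precedes the other in the
well-order. Invisible candidates may differ, but they cannot change which visible event is chosen
once a visible one is. -/
theorem Schedules.eq_of_visible_eq {x : Loc} {l : Lab} {S S' : State Ev Loc Lab PUnit.{u + 1}}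
    {e e' : Event Ev Loc Lab PUnit.{u + 1}} (hS : S.visible Sys l x = S'.visible Sys l x)
    (h : Schedules (lockingProtocol Sys) TS S e) (h' : Schedules (lockingProtocol Sys) TS S' e')
    (hx : e.loc Sys = x) (hx' : e'.loc Sys = x) (hl : e.label Sys ≤ l) (hl' : e'.label Sys ≤ l) :
    e = e' := by
  have hc := h.candidate
  have hc' := h'.candidate
  rw [hx, ← candidate_visible hl, hS, candidate_visible hl] at hc
  rw [hx', ← candidate_visible hl', ← hS, candidate_visible hl'] at hc'
  have h₁ := h.not_rel (hx ▸ hc')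
  have h₂ := h'.not_rel (hx' ▸ hc)
  rcases trichotomous_of WellOrderingRel e e' with h | h | h
  · exact absurd h h₂
  · exact h
  · exact absurd h h₁

end Protocol

/-! ### Relaxed observational determinism. -/

section Observation

variable {Sys : System Ev Loc Lab} {Body : Type u}

theorem Step.notMem {p : Protocol Sys Body} {TS : Set (Transaction Sys)}
    {S : State Ev Loc Lab Body} {e : Event Ev Loc Lab Body} (h : Step p TS S e) : e ∉ S :=
  h.elim (·.1) (·.2.1)

theorem CanOccur.isNIE {TS : Set (Transaction Sys)} {S : State Ev Loc Lab Body}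
    {e : Event Ev Loc Lab Body} (h : CanOccur TS S e) : e.IsNIE Sys := by
  cases e with
  | tx e =>
    obtain ⟨T, -, rfl⟩ := h
    exact T.startOf_eq _ T.start_mem
  | txDelay r => trivial
  | delay c k => trivial
  | _ => exact h.elim

theorem Step.schedules {p : Protocol Sys Body} {TS : Set (Transaction Sys)}
    {S : State Ev Loc Lab Body} {e : Event Ev Loc Lab Body} (h : Step p TS S e)
    (he : ¬ e.IsNIE Sys) : Schedules p TS S e :=
  h.resolve_left fun h' => he h'.2.isNIE

theorem Step.canOccur {p : Protocol Sys Body} {TS : Set (Transaction Sys)}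
    {S : State Ev Loc Lab Body} {e : Event Ev Loc Lab Body} (h : Step p TS S e)
    (he : e.IsNIE Sys) : CanOccur TS S e :=
  (h.resolve_right fun h' => h'.1 he).2

theorem Consistent.nodup {p : Protocol Sys Body} {TS : Set (Transaction Sys)}
    {E : Execution Ev Loc Lab Body} (h : Consistent p TS E) :
    E.steps.Nodup ∧ ∀ e ∈ E.steps, e ∉ E.start := by
  refine ⟨?_, fun e he hs => ?_⟩
  · rw [List.nodup_iff_sublist]
    intro a ha
    rw [List.cons_sublist_iff] at ha
    obtain ⟨r₁, r₂, hE, h₁, h₂⟩ := ha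
    rw [List.singleton_sublist] at h₂
    obtain ⟨s, t, rfl⟩ := List.append_of_mem h₂
    exact (h (r₁ ++ s) a t (by simp [hE])).notMem (.inr (by simp [h₁]))
  · obtain ⟨s, t, hE⟩ := List.append_of_mem he
    exact (h s e t hE).notMem (.inl hs)

theorem Execution.mem_trace {l : Lab} {x : Loc} {E : Execution Ev Loc Lab Body}
    {e : Event Ev Loc Lab Body} :
    e ∈ E.trace Sys l x ↔ e ∈ E.steps ∧ e.loc Sys = x ∧ e.label Sys ≤ l := by
  simp [Execution.trace]

/-- What is visible after an initial segment of an execution. -/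
theorem visible_after (S : State Ev Loc Lab Body) (F : List (Event Ev Loc Lab Body)) (l : Lab)
    (x : Loc) : (S.after F).visible Sys l x =
      S.visible Sys l x ∪ {e | e ∈ (Execution.mk S F).trace Sys l x} := by
  ext e
  simp only [State.visible, State.after, Execution.mem_trace, Set.mem_union, Set.mem_ofPred_eq]
  tauto

theorem Execution.exists_of_trace_eq {l : Lab} {x : Loc} {E : Execution Ev Loc Lab Body}
    {w r : List (Event Ev Loc Lab Body)} {e : Event Ev Loc Lab Body}
    (h : E.trace Sys l x = w ++ e :: r) :
    ∃ E₁ E₂, E.steps = E₁ ++ e :: E₂ ∧ (Execution.mk E.start E₁).trace Sys l x = w := by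
  obtain ⟨l₁, l₂, hE, h₁, h₂⟩ := List.filter_eq_append_iff.1 h
  obtain ⟨m₁, m₂, rfl, hm, -, -⟩ := List.filter_eq_cons_iff.1 h₂
  refine ⟨l₁ ++ m₁, m₂, by simp [hE], ?_⟩
  simp only [Execution.trace, List.filter_append, h₁]
  rw [List.filter_eq_nil_iff.2 hm, List.append_nil]

theorem prefix_total {α : Type*} {t t' : List α}
    (h : ∀ w a b r r', t = w ++ a :: r → t' = w ++ b :: r' → a = b) : t <+: t' ∨ t' <+: t := by
  induction t generalizing t' with
  | nil => exact .inl t'.nil_prefix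
  | cons a t ih =>
    cases t' with
    | nil => exact .inr (List.nil_prefix)
    | cons b t' =>
      obtain rfl : a = b := h [] a b t t' rfl rfl
      simp only [List.cons_prefix_cons, true_and]
      exact ih fun w c d r r' h₁ h₂ => h (a :: w) c d r r' (by simp [h₁]) (by simp [h₂])

/-- An initial segment of the trace is determined by the state that it leads to. -/
theorem Consistent.prefix_unique {p : Protocol Sys Body} {TS : Set (Transaction Sys)}
    {E : Execution Ev Loc Lab Body} (h : Consistent p TS E) {l : Lab} {x : Loc}
    {w w' : List (Event Ev Loc Lab Body)} (hw : w <+: E.trace Sys l x)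
    (hw' : w' <+: E.trace Sys l x)
    (heq : E.start.visible Sys l x ∪ {e | e ∈ w} = E.start.visible Sys l x ∪ {e | e ∈ w'}) :
    w = w' := by
  have key : ∀ v v' : List (Event Ev Loc Lab Body), v' <+: E.trace Sys l x → v <+: v' →
      E.start.visible Sys l x ∪ {e | e ∈ v} = E.start.visible Sys l x ∪ {e | e ∈ v'} →
      v = v' := by
    rintro v _ hv' ⟨t, rfl⟩ he
    cases t with
    | nil => simp
    | cons a t =>
      exfalso
      have ha : a ∈ E.start.visible Sys l x ∪ {e | e ∈ v} := by
        rw [he]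
        exact .inr (by simp)
      have hsub := hv'.sublist
      rcases ha with ha | ha
      · exact h.nodup.2 a (Execution.mem_trace.1 (hsub.subset (by simp))).1 ha.1
      · have hn : (v ++ a :: t).Nodup := (h.nodup.1.filter _).sublist hsub
        exact (List.disjoint_of_nodup_append hn) ha (by simp)
  rcases List.prefix_or_prefix_of_prefix hw hw' with h' | h'
  · exact key _ _ hw' h' heq
  · exact (key _ _ hw h' heq.symm).symm

/-- An input is recorded with the set of visible events before it. Since events never repeat, this
set fixes a position in the trace, by `prefix_unique`. -/
theorem Consistent.eq_of_input {p : Protocol Sys Body} {TS : Set (Transaction Sys)}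
    {E E' : Execution Ev Loc Lab Body} (h : Consistent p TS E) {l : Lab} {x : Loc}
    (hs : E.start.visible Sys l x = E'.start.visible Sys l x)
    (hi : E.inputs Sys l x = E'.inputs Sys l x)
    {w r' : List (Event Ev Loc Lab Body)} {b : Event Ev Loc Lab Body}
    (hw : w <+: E.trace Sys l x) (hw' : E'.trace Sys l x = w ++ b :: r') (hb : b.IsNIE Sys) :
    ∃ r, E.trace Sys l x = w ++ b :: r := by
  obtain ⟨E₁, E₂, hE, ht⟩ := Execution.exists_of_trace_eq hw'
  have hmem : b ∈ E'.trace Sys l x := by simp [hw']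
  have hin : (b, (E'.start.after E₁).visible Sys l x) ∈ E'.inputs Sys l x :=
    ⟨E₁, E₂, hE, hb, (Execution.mem_trace.1 hmem).2.1, (Execution.mem_trace.1 hmem).2.2, rfl⟩
  rw [← hi] at hin
  obtain ⟨F₁, F₂, hF, -, hx, hl, hV⟩ := hin
  have htr : E.trace Sys l x = (Execution.mk E.start F₁).trace Sys l x ++
      b :: (Execution.mk E.start F₂).trace Sys l x := by
    simp only at hF hx hl
    simp [Execution.trace, hF, hx, hl]
  have : w = (Execution.mk E.start F₁).trace Sys l x := by
    refine h.prefix_unique hw ⟨_, htr.symm⟩ ?_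
    simp only [visible_after, ht] at hV
    rw [hs, hV, hs]
  exact ⟨_, this ▸ htr⟩

theorem Consistent.step_of_trace_eq {p : Protocol Sys Body} {TS : Set (Transaction Sys)}
    {E : Execution Ev Loc Lab Body} (h : Consistent p TS E) {l : Lab} {x : Loc}
    {w r : List (Event Ev Loc Lab Body)} {e : Event Ev Loc Lab Body}
    (ht : E.trace Sys l x = w ++ e :: r) :
    e.loc Sys = x ∧ e.label Sys ≤ l ∧ ∃ S : State Ev Loc Lab Body, Step p TS S e ∧
      S.visible Sys l x = E.start.visible Sys l x ∪ {e | e ∈ w} := by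
  have hmem : e ∈ E.trace Sys l x := by simp [ht]
  obtain ⟨E₁, E₂, hE, hw⟩ := Execution.exists_of_trace_eq ht
  exact ⟨(Execution.mem_trace.1 hmem).2.1, (Execution.mem_trace.1 hmem).2.2, _, h E₁ e E₂ hE,
    by rw [visible_after, hw]⟩

theorem lockingProtocol_trace_next {TS : Set (Transaction Sys)}
    {E E' : Execution Ev Loc Lab PUnit.{u + 1}} (h : Consistent (lockingProtocol Sys) TS E)
    (h' : Consistent (lockingProtocol Sys) TS E') {l : Lab} {x : Loc}
    (hs : E.start.visible Sys l x = E'.start.visible Sys l x)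
    (hi : E.inputs Sys l x = E'.inputs Sys l x)
    {w r r' : List (Event Ev Loc Lab PUnit.{u + 1})} {a b : Event Ev Loc Lab PUnit.{u + 1}}
    (hw : E.trace Sys l x = w ++ a :: r) (hw' : E'.trace Sys l x = w ++ b :: r') : a = b := by
  by_cases hb : b.IsNIE Sys
  · obtain ⟨t, ht⟩ := h.eq_of_input hs hi ⟨_, hw.symm⟩ hw' hb
    exact (List.cons.inj (List.append_cancel_left (hw.symm.trans ht))).1
  by_cases ha : a.IsNIE Sys
  · obtain ⟨t, ht⟩ := h'.eq_of_input hs.symm hi.symm ⟨_, hw'.symm⟩ hw ha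
    exact (List.cons.inj (List.append_cancel_left (ht.symm.trans hw'))).1
  obtain ⟨hx, hl, S, hS, hV⟩ := h.step_of_trace_eq hw
  obtain ⟨hx', hl', S', hS', hV'⟩ := h'.step_of_trace_eq hw'
  exact (hS.schedules ha).eq_of_visible_eq (by rw [hV, hV', hs]) (hS'.schedules hb) hx hx' hl hl'

/-- A visible event that the other execution has in excess is either an input, hence shared, or a
candidate in the final state. In the latter case the location schedules something, though possibly a
different event, and is not idle. -/
theorem lockingProtocol_idle {TS : Set (Transaction Sys)}
    {E E' : Execution Ev Loc Lab PUnit.{u + 1}} (h : Consistent (lockingProtocol Sys) TS E)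
    (h' : Consistent (lockingProtocol Sys) TS E') {l : Lab} {x : Loc}
    (hs : E.start.visible Sys l x = E'.start.visible Sys l x)
    (hi : E.inputs Sys l x = E'.inputs Sys l x) (hid : Idle (lockingProtocol Sys) TS x E)
    (hp : E.trace Sys l x <+: E'.trace Sys l x) : E'.trace Sys l x <+: E.trace Sys l x := by
  obtain ⟨t, ht⟩ := hp
  cases t with
  | nil => exact ⟨[], by simpa using ht.symm⟩
  | cons b t =>
    exfalso
    by_cases hb : b.IsNIE Sys
    · obtain ⟨r, hr⟩ := h.eq_of_input hs hi (List.prefix_refl _) ht.symm hb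
      simp at hr
    obtain ⟨hx', hl', S', hS', hV'⟩ := h'.step_of_trace_eq ht.symm
    have hc := (hS'.schedules hb).candidate
    rw [hx', ← candidate_visible hl', hV', ← hs] at hc
    have hfin := visible_after (Sys := Sys) E.start E.steps l x
    rw [← hfin, candidate_visible hl'] at hc
    obtain ⟨e, he, hsch⟩ := hc.exists_schedules
    exact hid e he hsch

theorem lockingProtocol_relaxedObservationalDeterminism (TS : Set (Transaction Sys)) :
    RelaxedObservationalDeterminism (lockingProtocol Sys) TS := by
  intro l E E' _ _ h h' hs hi x
  have hd : E.trace Sys l x <+: E'.trace Sys l x ∨ E'.trace Sys l x <+: E.trace Sys l x :=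
    prefix_total fun w a b r r' => lockingProtocol_trace_next h h' (hs x) (hi x)
  exact ⟨hd, fun hid => hd.elim (lockingProtocol_idle h h' (hs x) (hi x) hid) id,
    fun hid => hd.elim id (lockingProtocol_idle h' h (hs x).symm (hi x).symm hid)⟩

end Observation

/-! ### Order of the actions in a plan, and numbering of the messages. -/

section Plan

variable {Sys : System Ev Loc Lab}

theorem lockKey_injective {x x' : Loc} {l l' : Lab} (h : lockKey x l = lockKey x' l') :
    x = x' ∧ l = l' := by
  have h := toLex.injective h
  rw [Prod.mk.injEq] at h
  have h₂ := toLex.injective h.2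
  rw [Prod.mk.injEq] at h₂
  exact ⟨embeddingToCardinal.injective h₂.2, h.1⟩

namespace Transaction

variable {T : Transaction Sys}

theorem mem_actions {a : Event Ev Loc Lab PUnit.{u + 1}} :
    a ∈ T.actions ↔ ∃ e ∈ T.events, e ≠ T.start ∧ (a = .tx e ∨
      a = acquire T.start (Sys.loc e) (Sys.label e) ∨
      a = release T.start (Sys.loc e) (Sys.label e)) := by
  simp only [actions, Finset.mem_biUnion, Finset.mem_erase, Finset.mem_insert,
    Finset.mem_singleton]
  exact ⟨fun ⟨e, h, h'⟩ => ⟨e, h.2, h.1, h'⟩, fun ⟨e, h, h', h''⟩ => ⟨e, ⟨h', h⟩, h''⟩⟩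

theorem mem_plan {a : Event Ev Loc Lab PUnit.{u + 1}} :
    a ∈ T.plan ↔ a = .tx T.start ∨ a ∈ T.actions := by
  simp [plan]

theorem tx_mem_plan {e : Ev} (he : e ∈ T.events) :
    (Event.tx e : Event Ev Loc Lab PUnit.{u + 1}) ∈ T.plan := by
  rw [mem_plan, mem_actions]
  by_cases h : e = T.start
  · exact .inl (h ▸ rfl)
  · exact .inr ⟨e, he, h, .inl rfl⟩

theorem nodup_plan : T.plan.Nodup := by
  rw [plan, List.nodup_cons, (List.mergeSort_perm _ _).nodup_iff]
  refine ⟨?_, Finset.nodup_toList _⟩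
  rw [List.mem_mergeSort, Finset.mem_toList, mem_actions]
  rintro ⟨e, -, h, h' | h' | h'⟩
  · exact h (Event.tx.inj h').symm
  · cases h'
  · cases h'

theorem pairwise_plan_tail : T.plan.tail.Pairwise fun a b => T.actionKey a ≤ T.actionKey b := by
  have := List.pairwise_mergeSort (le := fun a b => decide (T.actionKey a ≤ T.actionKey b))
    (fun a b c hab hbc => by
      simp only [decide_eq_true_eq] at *
      exact hab.trans hbc)
    (fun a b => by
      simp only [Bool.or_eq_true, decide_eq_true_eq]
      exact le_total _ _) T.actions.toList
  simpa [plan] using this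

theorem depth_lt {a b : Ev} (ha : a ∈ T.events) (hab : Sys.before a b) : T.depth a < T.depth b := by
  classical
  refine Finset.card_lt_card ⟨fun c hc => ?_, fun h => ?_⟩
  · rw [Finset.mem_filter] at hc ⊢
    exact ⟨hc.1, Sys.before_trans _ _ _ hc.2 hab⟩
  · have := h (Finset.mem_filter.2 ⟨ha, hab⟩)
    exact Sys.before_irrefl _ (Finset.mem_filter.1 this).2

theorem actionKey_tx_lt (hT : T.Secure) {a b : Ev} (ha : a ∈ T.events) (hb : b ∈ T.events)
    (hab : Sys.before a b) : T.actionKey (.tx a) < T.actionKey (.tx b) := by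
  have h₁ : toLinearExtension (Sys.label a) ≤ toLinearExtension (Sys.label b) :=
    toLinearExtension.monotone (hT a ha b hb hab)
  have h₂ := depth_lt ha hab
  simp only [actionKey, Prod.Lex.toLex_lt_toLex, lt_self_iff_false, true_and, false_or]
  rcases h₁.lt_or_eq with h | h
  · exact .inl h
  · exact .inr ⟨h, .inl (by omega)⟩

theorem actionKey_acquire_lt_tx (s e : Ev) :
    T.actionKey (acquire s (Sys.loc e) (Sys.label e)) < T.actionKey (.tx e) := by
  simp [actionKey, lockKey, Prod.Lex.toLex_lt_toLex]

theorem actionKey_tx_lt_release (s e : Ev) (x : Loc) (l : Lab) :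
    T.actionKey (.tx e) < T.actionKey (release s x l) := by
  simp [actionKey, Prod.Lex.toLex_lt_toLex]

theorem actionKey_acquire_lt_release (s t : Ev) (x y : Loc) (l m : Lab) :
    T.actionKey (acquire s x l) < T.actionKey (release t y m) := by
  simp [actionKey, Prod.Lex.toLex_lt_toLex]

theorem actionKey_acquire_le {s t : Ev} {x y : Loc} {l m : Lab} :
    T.actionKey (acquire s x l) ≤ T.actionKey (acquire t y m) ↔ lockKey x l ≤ lockKey y m := by
  simp [actionKey, Prod.Lex.toLex_le_toLex]

end Transaction

variable {TS : Set (Transaction Sys)}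

/-- The transaction `T` is executed as the run `s`. -/
structure Runs (TS : Set (Transaction Sys)) (s : Ev) (T : Transaction Sys) : Prop where
  mem : T ∈ TS
  start_eq : T.start = s
  plan_eq : runPlan TS s = T.plan

theorem exists_runs {T : Transaction Sys} (hT : T ∈ TS) : ∃ T', Runs TS T.start T' := by
  have h : ∃ T' ∈ TS, T'.start = T.start := ⟨T, hT, rfl⟩
  exact ⟨h.choose, h.choose_spec.1, h.choose_spec.2, dif_pos h⟩

theorem exists_runs_of_lt {s : Ev} {i : ℕ} (hi : i < (runPlan TS s).length) :
    ∃ T, Runs TS s T := by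
  by_cases h : ∃ T ∈ TS, T.start = s
  · obtain ⟨T, hT, rfl⟩ := h
    exact exists_runs hT
  · rw [runPlan, dif_neg h] at hi
    simp at hi

theorem action_eq_getElem {s : Ev} {i : ℕ} (hi : i < (runPlan TS s).length) :
    action TS s i = (runPlan TS s)[i] := by
  simp [action, hi]

theorem action_injective {s : Ev} {i j : ℕ} (hi : i < (runPlan TS s).length)
    (hj : j < (runPlan TS s).length) (h : action TS s i = action TS s j) : i = j := by
  obtain ⟨T, hT⟩ := exists_runs_of_lt hi
  rw [action_eq_getElem hi, action_eq_getElem hj] at h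
  have hn : (runPlan TS s).Nodup := hT.plan_eq ▸ T.nodup_plan
  exact (List.Nodup.getElem_inj_iff hn).1 h

namespace Runs

variable {s : Ev} {T : Transaction Sys} (hT : Runs TS s T)
include hT

theorem startOf_eq : Sys.startOf s = s := by
  rw [← hT.start_eq]
  exact T.startOf_eq _ T.start_mem

theorem length_pos : 0 < (runPlan TS s).length := by
  rw [hT.plan_eq]
  simp [Transaction.plan]

theorem action_zero : action TS s 0 = .tx s := by
  simp [action, hT.plan_eq, Transaction.plan, hT.start_eq]

theorem action_mem_plan {i : ℕ} (hi : i < (runPlan TS s).length) : action TS s i ∈ T.plan := by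
  rw [action_eq_getElem hi, ← hT.plan_eq]
  exact List.getElem_mem hi

theorem action_succ_mem {i : ℕ} (hi : i + 1 < (runPlan TS s).length) :
    action TS s (i + 1) ∈ T.actions := by
  rcases Transaction.mem_plan.1 (hT.action_mem_plan hi) with h | h
  · rw [hT.start_eq, ← hT.action_zero] at h
    have := action_injective hi hT.length_pos h
    omega
  · exact h

theorem exists_action {a : Event Ev Loc Lab PUnit.{u + 1}} (ha : a ∈ T.plan) :
    ∃ i < (runPlan TS s).length, action TS s i = a := by
  rw [← hT.plan_eq] at ha
  obtain ⟨i, hi, h⟩ := List.getElem_of_mem ha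
  exact ⟨i, hi, (action_eq_getElem hi).trans h⟩

theorem exists_action_succ {a : Event Ev Loc Lab PUnit.{u + 1}} (ha : a ∈ T.actions) :
    ∃ i, i + 1 < (runPlan TS s).length ∧ action TS s (i + 1) = a := by
  obtain ⟨i, hi, h⟩ := hT.exists_action (Transaction.mem_plan.2 (.inr ha))
  cases i with
  | succ i => exact ⟨i, hi, h⟩
  | zero =>
    exfalso
    rw [hT.action_zero] at h
    subst h
    obtain ⟨e, -, he, h | h | h⟩ := Transaction.mem_actions.1 ha
    · exact he (by rw [hT.start_eq, Event.tx.inj h])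
    · cases h
    · cases h

theorem actionKey_le {i j : ℕ} (hij : i < j) (hj : j + 1 < (runPlan TS s).length) :
    T.actionKey (action TS s (i + 1)) ≤ T.actionKey (action TS s (j + 1)) := by
  have hi : i + 1 < (runPlan TS s).length := by omega
  have h := List.pairwise_iff_getElem.1 T.pairwise_plan_tail i j
    (by rw [List.length_tail, ← hT.plan_eq]; omega)
    (by rw [List.length_tail, ← hT.plan_eq]; omega) hij
  rw [action_eq_getElem hi, action_eq_getElem hj]
  simpa [hT.plan_eq] using h

theorem lt_of_actionKey_lt {i j : ℕ} (hi : i + 1 < (runPlan TS s).length)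
    (h : T.actionKey (action TS s (i + 1)) < T.actionKey (action TS s (j + 1))) : i < j := by
  by_contra hij
  rcases (not_lt.1 hij).lt_or_eq with h' | rfl
  · exact absurd (hT.actionKey_le h' hi) (not_le.2 h)
  · exact lt_irrefl _ h

/-- Along happens-before labels do not decrease and depth grows, so the sort key grows strictly. The
start event stands outside the sorted part and is treated apart. -/
theorem exists_lt_of_before (hsec : T.Secure) {a b : Ev} (ha : a ∈ T.events) (hb : b ∈ T.events)
    (hab : Sys.before a b) : ∃ i j, i < j ∧ j < (runPlan TS s).length ∧
      action TS s i = .tx a ∧ action TS s j = .tx b := by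
  obtain ⟨i, hi, hia⟩ := hT.exists_action (T.tx_mem_plan ha)
  obtain ⟨j, hj, hjb⟩ := hT.exists_action (T.tx_mem_plan hb)
  refine ⟨i, j, ?_, hj, hia, hjb⟩
  cases j with
  | zero =>
    -- Nothing in the transaction happens before its start event.
    exfalso
    rw [hT.action_zero, Event.tx.injEq, ← hT.start_eq] at hjb
    subst hjb
    by_cases h : a = T.start
    · exact Sys.before_irrefl _ (h ▸ hab)
    · exact Sys.before_irrefl _ (Sys.before_trans _ _ _ hab (T.start_before a ha h))
  | succ j =>
    cases i with
    | zero => omega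
    | succ i =>
      have := hT.lt_of_actionKey_lt hi (j := j) (by
        rw [hia, hjb]
        exact T.actionKey_tx_lt hsec ha hb hab)
      omega

theorem action_cases {i : ℕ} (hi : i + 1 < (runPlan TS s).length) :
    ∃ e ∈ T.events, e ≠ s ∧ (action TS s (i + 1) = .tx e ∨
      action TS s (i + 1) = acquire s (Sys.loc e) (Sys.label e) ∨
      action TS s (i + 1) = release s (Sys.loc e) (Sys.label e)) := by
  have h := Transaction.mem_actions.1 (hT.action_succ_mem hi)
  rwa [hT.start_eq] at h

theorem action_spec {i : ℕ} (hi : i < (runPlan TS s).length) :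
    (action TS s i).run Sys = s ∧ ∃ e ∈ T.events, (action TS s i).loc Sys = Sys.loc e ∧
      (action TS s i).label Sys = Sys.label e := by
  cases i with
  | zero =>
    rw [hT.action_zero]
    exact ⟨hT.startOf_eq, s, hT.start_eq ▸ T.start_mem, rfl, rfl⟩
  | succ i =>
    obtain ⟨e, he, -, h | h | h⟩ := hT.action_cases hi <;> rw [h]
    · exact ⟨(T.startOf_eq e he).trans hT.start_eq, e, he, rfl, rfl⟩
    · exact ⟨rfl, e, he, rfl, rfl⟩
    · exact ⟨rfl, e, he, rfl, rfl⟩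

theorem not_isNIE {i : ℕ} (hi : i + 1 < (runPlan TS s).length) :
    ¬ (action TS s (i + 1)).IsNIE Sys := by
  obtain ⟨e, he, hne, h | h | h⟩ := hT.action_cases hi <;> rw [h]
  · intro h'
    exact hne (h'.symm.trans ((T.startOf_eq e he).trans hT.start_eq))
  · exact id
  · exact id

/-- Every action but the start event is covered by a lock. -/
theorem exists_lock {i : ℕ} (hi : i + 1 < (runPlan TS s).length) :
    ∃ j k, j ≤ i + 1 ∧ i + 1 ≤ k ∧ k < (runPlan TS s).length ∧
      action TS s j = acquire s ((action TS s (i + 1)).loc Sys) ((action TS s (i + 1)).label Sys) ∧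
      action TS s k =
        release s ((action TS s (i + 1)).loc Sys) ((action TS s (i + 1)).label Sys) := by
  obtain ⟨e, he, hne, h⟩ := hT.action_cases hi
  have hne' : e ≠ T.start := hT.start_eq ▸ hne
  obtain ⟨j, hj, hja⟩ := hT.exists_action_succ
    (Transaction.mem_actions.2 ⟨e, he, hne', .inr (.inl rfl)⟩)
  obtain ⟨k, hk, hka⟩ := hT.exists_action_succ
    (Transaction.mem_actions.2 ⟨e, he, hne', .inr (.inr rfl)⟩)
  rw [hT.start_eq] at hja hka
  have hloc : (action TS s (i + 1)).loc Sys = Sys.loc e ∧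
      (action TS s (i + 1)).label Sys = Sys.label e := by
    rcases h with h | h | h <;> rw [h] <;> exact ⟨rfl, rfl⟩
  rw [hloc.1, hloc.2]
  refine ⟨j + 1, k + 1, ?_, ?_, hk, hja, hka⟩
  · rcases h with h | h | h
    · have := hT.lt_of_actionKey_lt hj (j := i) (by
        rw [hja, h]
        exact T.actionKey_acquire_lt_tx s e)
      omega
    · exact (action_injective hj hi (hja.trans h.symm)).le
    · have := hT.lt_of_actionKey_lt hj (j := i) (by
        rw [hja, h]
        exact T.actionKey_acquire_lt_release _ _ _ _ _ _)
      omega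
  · rcases h with h | h | h
    · have := hT.lt_of_actionKey_lt hi (j := k) (by
        rw [hka, h]
        exact T.actionKey_tx_lt_release _ _ _ _)
      omega
    · have := hT.lt_of_actionKey_lt hi (j := k) (by
        rw [hka, h]
        exact T.actionKey_acquire_lt_release _ _ _ _ _ _)
      omega
    · exact (action_injective hi hk (h.trans hka.symm)).le

/-- All locks are acquired before any of them is released. -/
theorem acquire_lt_release {i j : ℕ} (hi : i < (runPlan TS s).length) {x y : Loc} {l m : Lab}
    (hx : action TS s i = acquire s x l) (hy : action TS s j = release s y m) : i < j := by
  cases i with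
  | zero =>
    rw [hT.action_zero] at hx
    cases hx
  | succ i =>
    cases j with
    | zero =>
      rw [hT.action_zero] at hy
      cases hy
    | succ j =>
      have := hT.lt_of_actionKey_lt hi (j := j) (by
        rw [hx, hy]
        exact T.actionKey_acquire_lt_release _ _ _ _ _ _)
      omega

theorem lockKey_lt {i j : ℕ} (hij : i < j) (hj : j < (runPlan TS s).length) {x y : Loc}
    {l m : Lab} (hx : action TS s i = acquire s x l) (hy : action TS s j = acquire s y m) :
    lockKey x l < lockKey y m := by
  cases i with
  | zero =>
    rw [hT.action_zero] at hx
    cases hx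
  | succ i =>
    obtain ⟨j, rfl⟩ : ∃ j', j = j' + 1 := ⟨j - 1, by omega⟩
    have hle := hT.actionKey_le (i := i) (j := j) (by omega) hj
    rw [hx, hy, Transaction.actionKey_acquire_le] at hle
    refine hle.lt_of_ne fun h => ?_
    obtain ⟨rfl, rfl⟩ := lockKey_injective h
    have := action_injective (by omega) hj (hx.trans hy.symm)
    omega

end Runs

theorem run_action {s : Ev} {i : ℕ} (hi : i < (runPlan TS s).length) :
    (action TS s i).run Sys = s := by
  obtain ⟨T, hT⟩ := exists_runs_of_lt hi
  exact (hT.action_spec hi).1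

/-- The channel names the run, and the count of earlier uses of a channel grows at each use. So
channel and number identify the step of the plan, although a plan may use a channel repeatedly. -/
theorem num_injective {s t : Ev} {i j : ℕ} (hc : chan TS s i = chan TS t j)
    (hn : num TS s i = num TS t j) : s = t ∧ i = j := by
  obtain rfl : s = t := congrArg Channel.run hc
  refine ⟨rfl, ?_⟩
  classical
  unfold num at hn
  rw [hc] at hn
  exact Nat.count_injective (p := fun k => chan TS s k = chan TS s j) hc rfl
    (by convert hn)

theorem exists_num_eq {s : Ev} {i k : ℕ} (hk : k < num TS s i) :
    ∃ j < i, chan TS s j = chan TS s i ∧ num TS s j = k := by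
  classical
  have key : ∀ n, k < Nat.count (fun j => chan TS s j = chan TS s i) n →
      ∃ j < n, chan TS s j = chan TS s i ∧
        Nat.count (fun j => chan TS s j = chan TS s i) j = k := by
    intro n
    induction n with
    | zero => simp
    | succ n ih =>
      intro h
      by_cases hlt : k < Nat.count (fun j => chan TS s j = chan TS s i) n
      · obtain ⟨j, hj, h⟩ := ih hlt
        exact ⟨j, by omega, h⟩
      · rw [Nat.count_succ] at h
        -- The count passes `k` exactly at `n`, so `n` is an index that uses the channel and has
        -- number `k`.
        split_ifs at h with hn
        · exact ⟨n, by omega, hn, by omega⟩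
        · omega
  obtain ⟨j, hj, hc, h⟩ := key i (by unfold num at hk; convert hk)
  refine ⟨j, hj, hc, ?_⟩
  rw [← h, num]
  congr 1
  simp only [hc]

end Plan

/-! ### Positions of events in an execution. -/

theorem after_empty {Ev : Type u} {Loc : Type v} {Lab : Type w} {Body : Type u}
    (E : List (Event Ev Loc Lab Body)) :
    (∅ : State Ev Loc Lab Body).after E = {e | e ∈ E} :=
  Set.empty_union _

open Classical in
/-- The position of an event in an execution; the length of the execution if it does not occur. -/
noncomputable def time {α : Type*} (E : List α) (e : α) : ℕ :=
  E.idxOf e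

theorem time_lt_length {α : Type*} {E : List α} {e : α} :
    time E e < E.length ↔ e ∈ E := by
  classical
  unfold time
  exact List.idxOf_lt_length_iff

theorem time_le_length {α : Type*} {E : List α} {e : α} :
    time E e ≤ E.length := by
  classical
  unfold time
  exact List.idxOf_le_length

theorem time_eq_length {α : Type*} {E : List α} {e : α}
    (h : e ∉ E) : time E e = E.length :=
  le_antisymm time_le_length (not_lt.1 fun h' => h (time_lt_length.1 h'))

theorem time_injective {α : Type*} {E : List α} {a b : α}
    (ha : a ∈ E) (h : time E a = time E b) : a = b := by
  classical
  unfold time at h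
  exact (List.idxOf_inj ha).1 h

theorem time_lt_iff {α : Type*} {E E₁ E₂ : List α} {a b : α}
    (hE : E = E₁ ++ b :: E₂) (hn : E.Nodup) : time E a < time E b ↔ a ∈ E₁ := by
  classical
  subst hE
  have hb : b ∉ E₁ := fun h => List.disjoint_of_nodup_append hn h (by simp)
  unfold time
  rw [List.idxOf_append_of_notMem hb, List.idxOf_cons_self, add_zero]
  constructor
  · intro h
    by_contra ha
    rw [List.idxOf_append_of_notMem ha] at h
    omega
  · intro h
    rw [List.idxOf_append_of_mem h]
    exact List.idxOf_lt_length_iff.2 h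

theorem time_lt_of_sublist {α : Type*} {E : List α} {a b : α}
    (hn : E.Nodup) (h : [a, b].Sublist E) : time E a < time E b := by
  rw [List.cons_sublist_iff] at h
  obtain ⟨r₁, r₂, rfl, h₁, h₂⟩ := h
  rw [List.singleton_sublist] at h₂
  obtain ⟨s, t, rfl⟩ := List.append_of_mem h₂
  rw [time_lt_iff (E₁ := r₁ ++ s) (E₂ := t) (by simp) hn]
  simp [h₁]

/-! ### Steps of full executions. -/

section Execution

variable {Sys : System Ev Loc Lab} {Body : Type u} {p : Protocol Sys Body}
  {TS : Set (Transaction Sys)}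

theorem FullConsistent.step {E₁ E₂ : List (Event Ev Loc Lab Body)} {e : Event Ev Loc Lab Body}
    (h : FullConsistent p TS (E₁ ++ e :: E₂)) : Step p TS {a | a ∈ E₁} e := by
  have := h E₁ e E₂ rfl
  rwa [after_empty] at this

theorem FullConsistent.of_append {E₁ E₂ : List (Event Ev Loc Lab Body)}
    (h : FullConsistent p TS (E₁ ++ E₂)) : FullConsistent p TS E₁ := by
  intro F₁ e F₂ hF
  simp only at hF
  exact h F₁ e (F₂ ++ E₂) (by simp [hF])

theorem FullConsistent.concat {E : List (Event Ev Loc Lab Body)} {e : Event Ev Loc Lab Body}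
    (h : FullConsistent p TS E) (he : Step p TS {a | a ∈ E} e) :
    FullConsistent p TS (E ++ [e]) := by
  intro F₁ a F₂ hF
  simp only at hF
  rcases List.eq_nil_or_concat F₂ with rfl | ⟨F₂, b, rfl⟩
  · obtain ⟨rfl, h⟩ := List.append_inj' hF rfl
    rw [List.cons.injEq] at h
    rw [← h.1, after_empty]
    exact he
  · rw [List.concat_eq_append, ← List.cons_append, ← List.append_assoc] at hF
    exact h F₁ a F₂ (List.append_inj' hF rfl).1

theorem FullConsistent.nodup {E : List (Event Ev Loc Lab Body)} (h : FullConsistent p TS E) :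
    E.Nodup :=
  (Consistent.nodup h).1

theorem CanOccur.mono {S S' : State Ev Loc Lab Body} {e : Event Ev Loc Lab Body}
    (h : CanOccur TS S e) (hS : S ⊆ S') : CanOccur TS S' e := by
  cases e with
  | tx e => exact h
  | txDelay r =>
    obtain ⟨h, a, ha, h'⟩ := h
    exact ⟨h, a, ha, hS h'⟩
  | delay c k =>
    obtain ⟨l, b, h⟩ := h
    exact ⟨l, b, hS h⟩
  | _ => exact h

end Execution

/-! ### Runs follow their plans. -/

section Locking

variable {Sys : System Ev Loc Lab} {TS : Set (Transaction Sys)}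
  {E : List (Event Ev Loc Lab PUnit.{u + 1})}

theorem Triggered.not_isNIE {V : State Ev Loc Lab PUnit.{u + 1}}
    {e : Event Ev Loc Lab PUnit.{u + 1}} (h : Triggered TS V e) : ¬ e.IsNIE Sys := by
  cases h with
  | send s i hi h => exact id
  | recv s i hi h => exact id
  | act s i hi h =>
    obtain ⟨T, hT⟩ := exists_runs_of_lt hi
    exact hT.not_isNIE hi

/-- Actions are neither sendings nor receipts, and an action determines its run and its index, so
only one trigger is possible. -/
theorem Triggered.recvEv_mem {V : State Ev Loc Lab PUnit.{u + 1}} {s : Ev} {i : ℕ}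
    (hi : i + 1 < (runPlan TS s).length) (h : Triggered TS V (action TS s (i + 1))) :
    recvEv TS s i ∈ V := by
  obtain ⟨T, hT⟩ := exists_runs_of_lt hi
  generalize hx : action TS s (i + 1) = x at h
  cases h with
  | send t j hj h =>
    obtain ⟨e, -, -, h | h | h⟩ := hT.action_cases hi <;> rw [h] at hx <;> cases hx
  | recv t j hj h =>
    obtain ⟨e, -, -, h | h | h⟩ := hT.action_cases hi <;> rw [h] at hx <;> cases hx
  | act t j hj h =>
    obtain rfl : s = t := by
      rw [← run_action hi, hx, run_action hj]
    have := action_injective hi hj hx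
    obtain rfl : i = j := by omega
    exact h

theorem Triggered.delayEv_mem {V : State Ev Loc Lab PUnit.{u + 1}} {s : Ev} {i : ℕ}
    (h : Triggered TS V (recvEv TS s i)) : delayEv TS s i ∈ V := by
  generalize hx : recvEv TS s i = x at h
  cases h with
  | send t j hj h => cases hx
  | recv t j hj h =>
    rw [recvEv, recvEv, Event.recv.injEq] at hx
    obtain ⟨rfl, rfl⟩ := num_injective hx.1 hx.2.1
    exact h
  | act t j hj h =>
    obtain ⟨T, hT⟩ := exists_runs_of_lt hj
    obtain ⟨e, -, -, h | h | h⟩ := hT.action_cases hj <;> rw [h] at hx <;> cases hx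

theorem Triggered.exists_sendEv {V : State Ev Loc Lab PUnit.{u + 1}}
    {c : Channel Ev Loc Lab} {k : ℕ} {l : Lab} {b : PUnit.{u + 1}}
    (h : Triggered TS V (.send c k l b)) :
    ∃ s i, i + 1 < (runPlan TS s).length ∧ action TS s i ∈ V ∧ .send c k l b = sendEv TS s i := by
  generalize hx : Event.send c k l b = x at h
  cases h with
  | send t j hj h => exact ⟨t, j, hj, h, rfl⟩
  | recv t j hj h => cases hx
  | act t j hj h =>
    obtain ⟨T, hT⟩ := exists_runs_of_lt hj
    obtain ⟨e, -, -, h | h | h⟩ := hT.action_cases hj <;> rw [h] at hx <;> cases hx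

theorem FullConsistent.triggered (h : FullConsistent (lockingProtocol Sys) TS E)
    {e : Event Ev Loc Lab PUnit.{u + 1}} (he : e ∈ E) (hne : ¬ e.IsNIE Sys) :
    Triggered TS {a | a ∈ E} e := by
  obtain ⟨E₁, E₂, rfl⟩ := List.append_of_mem he
  exact (h.step.schedules hne).candidate.2.2.2.1.mono fun a (ha : a ∈ E₁) => by simp [ha]

theorem FullConsistent.canOccur (h : FullConsistent (lockingProtocol Sys) TS E)
    {e : Event Ev Loc Lab PUnit.{u + 1}} (he : e ∈ E) (hne : e.IsNIE Sys) :
    CanOccur TS {a | a ∈ E} e := by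
  obtain ⟨E₁, E₂, rfl⟩ := List.append_of_mem he
  exact (h.step.canOccur hne).mono fun a (ha : a ∈ E₁) => by simp [ha]

/-- A delay event names only channel and number. These determine the whole message, its label
included, so the delay can be traced back to the action that precedes it. -/
theorem FullConsistent.eq_sendEv (h : FullConsistent (lockingProtocol Sys) TS E) {s : Ev} {i : ℕ}
    {l : Lab} {b : PUnit.{u + 1}} (he : .send (chan TS s i) (num TS s i) l b ∈ E) :
    .send (chan TS s i) (num TS s i) l b = sendEv TS s i ∧ action TS s i ∈ E := by
  obtain ⟨t, j, hj, hm, heq⟩ := (h.triggered he id).exists_sendEv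
  have heq' := heq
  rw [sendEv, Event.send.injEq] at heq'
  obtain ⟨rfl, rfl⟩ := num_injective heq'.1 heq'.2.1
  exact ⟨heq, hm⟩

theorem FullConsistent.action_mem_of_sendEv (h : FullConsistent (lockingProtocol Sys) TS E)
    {s : Ev} {i : ℕ} (he : sendEv TS s i ∈ E) : action TS s i ∈ E :=
  (h.eq_sendEv he).2

theorem FullConsistent.sendEv_mem (h : FullConsistent (lockingProtocol Sys) TS E)
    {s : Ev} {i : ℕ} (he : delayEv TS s i ∈ E) : sendEv TS s i ∈ E := by
  have hc : CanOccur TS {a | a ∈ E} (.delay (chan TS s i) (num TS s i)) := h.canOccur he trivial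
  obtain ⟨l, b, hs⟩ := hc
  exact (h.eq_sendEv hs).1 ▸ hs

theorem FullConsistent.delayEv_mem (h : FullConsistent (lockingProtocol Sys) TS E)
    {s : Ev} {i : ℕ} (he : recvEv TS s i ∈ E) : delayEv TS s i ∈ E :=
  (h.triggered he id).delayEv_mem

theorem FullConsistent.action_mem_of_recvEv (h : FullConsistent (lockingProtocol Sys) TS E)
    {s : Ev} {i : ℕ} (he : recvEv TS s i ∈ E) : action TS s i ∈ E :=
  h.action_mem_of_sendEv (h.sendEv_mem (h.delayEv_mem he))

theorem FullConsistent.recvEv_mem (h : FullConsistent (lockingProtocol Sys) TS E)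
    {s : Ev} {i : ℕ} (hi : i + 1 < (runPlan TS s).length) (he : action TS s (i + 1) ∈ E) :
    recvEv TS s i ∈ E := by
  obtain ⟨T, hT⟩ := exists_runs_of_lt hi
  exact (h.triggered he (hT.not_isNIE hi)).recvEv_mem hi

/-- The actions of a run occur in their order. -/
theorem FullConsistent.action_lt (h : FullConsistent (lockingProtocol Sys) TS E) {s : Ev}
    {i j : ℕ} (hij : i < j) (hj : j < (runPlan TS s).length) (he : action TS s j ∈ E) :
    action TS s i ∈ E ∧ time E (action TS s i) < time E (action TS s j) := by
  induction j, hij using Nat.le_induction with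
  | base =>
    obtain ⟨E₁, E₂, hE⟩ := List.append_of_mem he
    obtain ⟨T, hT⟩ := exists_runs_of_lt hj
    have h' := hE ▸ h
    have hr : recvEv TS s i ∈ E₁ :=
      (h'.step.schedules (hT.not_isNIE hj)).candidate.2.2.2.1.recvEv_mem hj
    have ha := h'.of_append.action_mem_of_recvEv hr
    exact ⟨by simp [hE, ha], (time_lt_iff hE h.nodup).2 ha⟩
  | succ j hij ih =>
    obtain ⟨E₁, E₂, hE⟩ := List.append_of_mem he
    obtain ⟨T, hT⟩ := exists_runs_of_lt hj
    have h' := hE ▸ h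
    have hr : recvEv TS s j ∈ E₁ :=
      (h'.step.schedules (hT.not_isNIE hj)).candidate.2.2.2.1.recvEv_mem hj
    have ha := h'.of_append.action_mem_of_recvEv hr
    obtain ⟨h₁, h₂⟩ := ih (by omega) (by simp [hE, ha])
    exact ⟨h₁, h₂.trans ((time_lt_iff hE h.nodup).2 ha)⟩

theorem FullConsistent.action_le (h : FullConsistent (lockingProtocol Sys) TS E) {s : Ev}
    {i j : ℕ} (hij : i ≤ j) (hj : j < (runPlan TS s).length) :
    time E (action TS s i) ≤ time E (action TS s j) := by
  rcases hij.lt_or_eq with hij | rfl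
  · by_cases he : action TS s j ∈ E
    · exact (h.action_lt hij hj he).2.le
    · rw [time_eq_length he]
      exact time_le_length
  · exact le_rfl

theorem FullConsistent.action_mem (h : FullConsistent (lockingProtocol Sys) TS E) {s : Ev}
    {i j : ℕ} (hij : i ≤ j) (hj : j < (runPlan TS s).length) (he : action TS s j ∈ E) :
    action TS s i ∈ E := by
  rcases hij.lt_or_eq with hij | rfl
  · exact (h.action_lt hij hj he).1
  · exact he

theorem FullConsistent.exists_action_tx (h : FullConsistent (lockingProtocol Sys) TS E) {e : Ev}
    (he : .tx e ∈ E) :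
    ∃ i < (runPlan TS (Sys.startOf e)).length, action TS (Sys.startOf e) i = .tx e := by
  by_cases hs : Sys.startOf e = e
  · obtain ⟨T, hT, rfl⟩ : ∃ T ∈ TS, T.start = e := h.canOccur he hs
    obtain ⟨T', hT'⟩ := exists_runs hT
    rw [hs]
    exact ⟨0, hT'.length_pos, hT'.action_zero⟩
  · have ht := h.triggered he hs
    generalize hx : Event.tx e = x at ht
    cases ht with
    | send => cases hx
    | recv => cases hx
    | act s i hi h =>
      obtain rfl : s = Sys.startOf e := by rw [← run_action hi, ← hx]; rfl
      exact ⟨i + 1, hi, rfl⟩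

theorem FullConsistent.exists_action_sync (h : FullConsistent (lockingProtocol Sys) TS E) {s : Ev}
    {x : Loc} {l : Lab} {k : ℕ} (he : .sync s x l k ∈ E) :
    ∃ i, i + 1 < (runPlan TS s).length ∧ action TS s (i + 1) = .sync s x l k := by
  have ht := h.triggered he id
  generalize hx : Event.sync s x l k = x at ht
  cases ht with
  | send => cases hx
  | recv => cases hx
  | act t i hi h =>
    obtain rfl : t = s := by rw [← run_action hi, ← hx]; rfl
    exact ⟨i, hi, rfl⟩

theorem FullConsistent.start_mem (h : FullConsistent (lockingProtocol Sys) TS E) {s : Ev} {i : ℕ}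
    (hi : i < (runPlan TS s).length) (he : action TS s i ∈ E) : .tx s ∈ E := by
  obtain ⟨T, hT⟩ := exists_runs_of_lt hi
  rw [← hT.action_zero]
  exact h.action_mem (Nat.zero_le i) hi he

/-! ### Legality of the scheduled events. -/

theorem participant_action {s : Ev} {i : ℕ} (hi : i < (runPlan TS s).length)
    (hs : .tx s ∈ E) : Participant TS {a | a ∈ E} ((action TS s i).loc Sys) ∧
      (action TS s i).label Sys ∈ Sys.permitted ((action TS s i).loc Sys) := by
  obtain ⟨T, hT⟩ := exists_runs_of_lt hi
  obtain ⟨-, e, he, h₁, h₂⟩ := hT.action_spec hi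
  refine ⟨⟨T, hT.mem, hT.start_eq ▸ hs, e, he, h₁.symm⟩, ?_⟩
  rw [h₁, h₂]
  exact T.label_permitted e he

theorem lockingProtocol_sound (hTS : ∀ T ∈ TS, T.Secure) :
    Sound (lockingProtocol Sys) TS := by
  intro E e h hne
  have hE := h.of_append
  obtain ⟨-, -, hmem, htr, hg⟩ := (h.step.schedules hne).candidate
  cases htr with
  | send s i hi ha =>
    have hs := hE.start_mem (by omega) ha
    have h₁ := participant_action (TS := TS) (i := i) (by omega) hs
    have h₂ := participant_action hi hs
    refine ⟨hs, h₁.1, h₂.1, h₁.2, h₂.2, fun k hk => ?_, fun l b hm => ?_⟩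
    -- An earlier message on the channel follows some action `j < i`. As action `j + 1` has
    -- occurred, that message has been received, hence sent.
    · obtain ⟨j, hj, hc, rfl⟩ := exists_num_eq hk
      rw [← hc]
      have ha' : action TS s (j + 1) ∈ E := hE.action_mem hj (by omega) ha
      exact ⟨_, _, hE.sendEv_mem (hE.delayEv_mem (hE.recvEv_mem (by omega) ha'))⟩
    · exact hmem ((hE.eq_sendEv hm).1 ▸ hm)
  | recv s i hi ha => exact ⟨ha, _, hE.sendEv_mem ha⟩
  | act s i hi ha =>
    obtain ⟨T, hT⟩ := exists_runs_of_lt hi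
    have ha' := hE.action_mem_of_recvEv ha
    have hs := hE.start_mem (by omega) ha'
    have hpa := participant_action hi hs
    obtain ⟨e, he, hes, h' | h' | h'⟩ := hT.action_cases hi
    · have hst : Sys.startOf e = s := (T.startOf_eq e he).trans hT.start_eq
      rw [h'] at hmem hg ⊢
      refine ⟨fun h => hes (h.symm.trans hst), T, hT.mem, he, fun a haE hae => ?_,
        fun a haT hae => ?_, fun a hr => hg.1 e a rfl hr⟩
      · obtain ⟨j, hj, hja⟩ := hE.exists_action_tx haE
        rw [hae, hst] at hj hja
        have haT : a ∈ T.events := by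
          cases j with
          | zero =>
            rw [hT.action_zero, Event.tx.injEq] at hja
            rw [← hja, ← hT.start_eq]
            exact T.start_mem
          | succ j =>
            obtain ⟨b, hb, -, h | h | h⟩ := hT.action_cases hj <;> rw [h] at hja <;> cases hja
            exact hb
        -- If `a` came after `e` in happens-before, it would come later in the plan, and `e` would
        -- have occurred already.
        refine ⟨haT, fun hbef => hmem ?_⟩
        obtain ⟨m, n, hmn, hn, hm, hna⟩ := hT.exists_lt_of_before (hTS T hT.mem) he haT hbef
        rw [← hm]
        exact hE.action_mem hmn.le hn (hna ▸ haE)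
      · obtain ⟨m, n, hmn, hn, hm, hna⟩ := hT.exists_lt_of_before (hTS T hT.mem) haT he hae
        have := action_injective hn hi (hna.trans h'.symm)
        rw [← hm]
        exact hE.action_mem (by omega) (by omega) ha'
    · rw [h'] at hpa ⊢
      exact ⟨hs, hpa⟩
    · rw [h'] at hpa ⊢
      exact ⟨hs, hpa⟩

/-! ### Serializability by two-phase locking. -/

theorem FullConsistent.release_lt_acquire (h : FullConsistent (lockingProtocol Sys) TS E)
    {s t : Ev} {x : Loc} {l : Lab} (ht : acquire t x l ∈ E)
    (hst : time E (acquire s x l) < time E (acquire t x l)) :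
    time E (release s x l) < time E (acquire t x l) := by
  obtain ⟨E₁, E₂, hE⟩ := List.append_of_mem ht
  rw [time_lt_iff hE h.nodup] at hst ⊢
  have h' := hE ▸ h
  exact (h'.step.schedules id).candidate.2.2.2.2.2 t x l rfl s hst

theorem FullConsistent.lock_bounds (h : FullConsistent (lockingProtocol Sys) TS E) {s : Ev} {i : ℕ}
    (hi : i + 1 < (runPlan TS s).length) (he : action TS s (i + 1) ∈ E) {x : Loc} {l : Lab}
    (hx : (action TS s (i + 1)).loc Sys = x) (hl : (action TS s (i + 1)).label Sys = l) :
    acquire s x l ∈ E ∧ time E (acquire s x l) ≤ time E (action TS s (i + 1)) ∧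
      time E (action TS s (i + 1)) ≤ time E (release s x l) := by
  obtain ⟨T, hT⟩ := exists_runs_of_lt hi
  obtain ⟨j, k, hj, hk, hkn, hja, hka⟩ := hT.exists_lock hi
  rw [hx, hl] at hja hka
  rw [← hja, ← hka]
  exact ⟨h.action_mem hj hi he, h.action_le hj hi, h.action_le hk hkn⟩

theorem FullConsistent.acquire_lt_release (h : FullConsistent (lockingProtocol Sys) TS E) {s : Ev}
    {x y : Loc} {l m : Lab} (ha : acquire s x l ∈ E) (hr : release s y m ∈ E) :
    time E (acquire s x l) < time E (release s y m) := by
  obtain ⟨i, hi, hx⟩ := h.exists_action_sync ha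
  obtain ⟨j, hj, hy⟩ := h.exists_action_sync hr
  obtain ⟨T, hT⟩ := exists_runs_of_lt hi
  have hij := hT.acquire_lt_release hi hx hy
  have := (h.action_lt hij hj (by rw [hy]; exact hr)).2
  rw [hx, hy] at this
  exact this

/-- The run `s` has released a lock before the run `t` acquires one. -/
def Earlier (E : List (Event Ev Loc Lab PUnit.{u + 1})) (s t : Ev) : Prop :=
  ∃ x l y m, time E (release s x l) < time E (acquire t y m) ∧ acquire t y m ∈ E

/-- The middle run acquires a lock and releases another; being two-phase, it does so in this order,
which joins the two inequalities. -/
theorem FullConsistent.earlier_trans (h : FullConsistent (lockingProtocol Sys) TS E)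
    {r s t : Ev} (h₁ : Earlier E r s) (h₂ : Earlier E s t) : Earlier E r t := by
  obtain ⟨x, l, y, m, hlt, hm⟩ := h₁
  obtain ⟨x', l', y', m', hlt', hm'⟩ := h₂
  -- An event that does not occur has the largest possible `time`, so one that is strictly earlier
  -- than some other has occurred.
  have hr : release s x' l' ∈ E := time_lt_length.1 (hlt'.trans (time_lt_length.2 hm'))
  exact ⟨x, l, y', m', hlt.trans ((h.acquire_lt_release hm hr).trans hlt'), hm'⟩

theorem FullConsistent.not_earlier_self (h : FullConsistent (lockingProtocol Sys) TS E)
    {s : Ev} : ¬ Earlier E s s := by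
  rintro ⟨x, l, y, m, hlt, hm⟩
  have hr : release s x l ∈ E := time_lt_length.1 (hlt.trans (time_lt_length.2 hm))
  exact lt_asymm hlt (h.acquire_lt_release hm hr)

/-- Runs that use the same lock do so one after the other. -/
theorem FullConsistent.earlier_of_lock (h : FullConsistent (lockingProtocol Sys) TS E)
    {s t : Ev} {i j : ℕ} (hst : s ≠ t) (hi : i + 1 < (runPlan TS s).length)
    (hj : j + 1 < (runPlan TS t).length) (hia : action TS s (i + 1) ∈ E)
    (hja : action TS t (j + 1) ∈ E)
    (hx : (action TS s (i + 1)).loc Sys = (action TS t (j + 1)).loc Sys)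
    (hl : (action TS s (i + 1)).label Sys = (action TS t (j + 1)).label Sys)
    (hlt : time E (action TS s (i + 1)) < time E (action TS t (j + 1))) : Earlier E s t := by
  obtain ⟨hs, hs₁, hs₂⟩ := h.lock_bounds hi hia hx hl
  obtain ⟨ht, ht₁, ht₂⟩ := h.lock_bounds hj hja rfl rfl
  refine ⟨(action TS t (j + 1)).loc Sys, (action TS t (j + 1)).label Sys, _, _, ?_, ht⟩
  rcases lt_trichotomy (time E (acquire s ((action TS t (j + 1)).loc Sys)
    ((action TS t (j + 1)).label Sys))) (time E (acquire t ((action TS t (j + 1)).loc Sys)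
    ((action TS t (j + 1)).label Sys))) with h' | h' | h'
  · exact h.release_lt_acquire ht h'
  · have := time_injective hs h'
    rw [acquire, acquire, Event.sync.injEq] at this
    exact absurd this.1 hst
  -- Had `t` held the lock first, its action would precede its release, hence the acquisition and
  -- the action by `s`, against `hlt`.
  · have := h.release_lt_acquire hs h'
    omega

/-- Between different runs only conflicts and common locks remain. Conflicting events are not start
events, so a lock covers each of them. -/
theorem FullConsistent.earlier_of_direct (h : FullConsistent (lockingProtocol Sys) TS E)
    {a b : Event Ev Loc Lab PUnit.{u + 1}} (hab : [a, b].Sublist E) (hd : a.Direct Sys b) :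
    a.run Sys = b.run Sys ∨ Earlier E (a.run Sys) (b.run Sys) := by
  have ha : a ∈ E := hab.subset (by simp)
  have hb : b ∈ E := hab.subset (by simp)
  have hlt := time_lt_of_sublist h.nodup hab
  rw [or_iff_not_imp_left]
  intro hne
  cases hd with
  | code a b hs _ => exact absurd hs hne
  | conflict a b hc =>
    obtain ⟨i, hi, hia⟩ := h.exists_action_tx ha
    obtain ⟨j, hj, hjb⟩ := h.exists_action_tx hb
    obtain ⟨T, hT⟩ := exists_runs_of_lt hi
    obtain ⟨T', hT'⟩ := exists_runs_of_lt hj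
    cases i with
    | zero =>
      rw [hT.action_zero, Event.tx.injEq] at hia
      exact absurd hia (Sys.conflict_not_start a b hc)
    | succ i =>
      cases j with
      | zero =>
        rw [hT'.action_zero, Event.tx.injEq] at hjb
        exact absurd hjb (Sys.conflict_not_start b a (Sys.conflict_symm a b hc))
      | succ j =>
        refine h.earlier_of_lock (s := Sys.startOf a) (t := Sys.startOf b) hne hi hj (hia ▸ ha)
          (hjb ▸ hb) ?_ ?_ (by rwa [hia, hjb])
        · rw [hia, hjb]
          exact Sys.conflict_loc a b hc
        · rw [hia, hjb]
          exact Sys.conflict_label a b hc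
  | txSend a r hs =>
    obtain ⟨⟨T, -, hr⟩, -⟩ := h.canOccur hb trivial
    exact absurd ((T.startOf_eq a (T.sendOf_mem r hr a hs).1).trans (T.startOf_eq r hr).symm) hne
  | txReceive r => exact absurd rfl hne
  | send c k l b => exact absurd rfl hne
  | receive c k b => exact absurd rfl hne
  | lock s t x l k k' =>
    obtain ⟨i, hi, hia⟩ := h.exists_action_sync ha
    obtain ⟨j, hj, hjb⟩ := h.exists_action_sync hb
    exact h.earlier_of_lock (s := s) (t := t) hne hi hj (hia ▸ ha) (hjb ▸ hb)
      (by rw [hia, hjb]; rfl) (by rw [hia, hjb]; rfl) (by rwa [hia, hjb])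
  | thread a b _ hr _ => exact absurd hr hne

theorem FullConsistent.earlier_of_happensBefore (h : FullConsistent (lockingProtocol Sys) TS E)
    {a b : Event Ev Loc Lab PUnit.{u + 1}} (hab : HappensBefore Sys E a b) :
    a.run Sys = b.run Sys ∨ Earlier E (a.run Sys) (b.run Sys) := by
  induction hab with
  | single hab => exact h.earlier_of_direct hab.1 hab.2
  | tail _ hab ih =>
    have := h.earlier_of_direct hab.1 hab.2
    rcases ih with ih | ih
    · rwa [ih]
    · exact .inr (this.elim (fun h' => h' ▸ ih) (h.earlier_trans ih))

theorem lockingProtocol_serializable (h : FullConsistent (lockingProtocol Sys) TS E) :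
    Serializable Sys E := by
  have key : ∀ s t, Relation.TransGen (DependsOn Sys E) s t → Earlier E s t := by
    have hd : ∀ s t, DependsOn Sys E s t → Earlier E s t := by
      rintro s t ⟨hst, a, b, rfl, rfl, hab⟩
      exact (h.earlier_of_happensBefore hab).resolve_left hst
    intro s t hst
    induction hst with
    | single hst => exact hd _ _ hst
    | tail _ hst ih => exact h.earlier_trans ih (hd _ _ hst)
  exact { irrefl := fun s hs => h.not_earlier_self (key s s hs)
          trans := fun _ _ _ => Relation.TransGen.trans }

end Locking

/-! ### Deadlock freedom. -/

section Progress

variable {Sys : System Ev Loc Lab} {TS : Set (Transaction Sys)}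
  {E : List (Event Ev Loc Lab PUnit.{u + 1})}

/-- The network delay event of a transaction event. -/
def delayOf : Event Ev Loc Lab PUnit.{u + 1} → Event Ev Loc Lab PUnit.{u + 1}
  | .tx r => .txDelay r
  | e => e

theorem run_delayOf (e : Event Ev Loc Lab PUnit.{u + 1}) :
    (delayOf e).run Sys = e.run Sys := by
  cases e <;> rfl

/-- The events that complete the run `s`. -/
def obligations (TS : Set (Transaction Sys)) (s : Ev) : Set (Event Ev Loc Lab PUnit.{u + 1}) :=
  -- The last index contributes messages that are never sent; this is harmless, since only
  -- finiteness and containing every needed event matter.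
  ⋃ i ∈ Set.Iio (runPlan TS s).length, {action TS s i, sendEv TS s i, delayEv TS s i,
    recvEv TS s i, delayOf (action TS s i)}

theorem finite_obligations (s : Ev) : (obligations TS s).Finite :=
  (Set.finite_Iio _).biUnion fun _ _ => Set.toFinite _

theorem mem_obligations {s : Ev} {e : Event Ev Loc Lab PUnit.{u + 1}} :
    e ∈ obligations TS s ↔ ∃ i < (runPlan TS s).length, e = action TS s i ∨ e = sendEv TS s i ∨
      e = delayEv TS s i ∨ e = recvEv TS s i ∨ e = delayOf (action TS s i) := by
  simp [obligations]

theorem run_of_mem_obligations {s : Ev} {e : Event Ev Loc Lab PUnit.{u + 1}}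
    (h : e ∈ obligations TS s) : e.run Sys = s ∧ Sys.startOf s = s := by
  obtain ⟨i, hi, h⟩ := mem_obligations.1 h
  obtain ⟨T, hT⟩ := exists_runs_of_lt hi
  refine ⟨?_, hT.startOf_eq⟩
  rcases h with rfl | rfl | rfl | rfl | rfl
  · exact run_action hi
  · rfl
  · rfl
  · rfl
  · rw [run_delayOf, run_action hi]

theorem FullConsistent.exists_obligations (h : FullConsistent (lockingProtocol Sys) TS E)
    {e : Event Ev Loc Lab PUnit.{u + 1}} (ht : Triggered TS {a | a ∈ E} e) :
    ∃ s, .tx s ∈ E ∧ e ∈ obligations TS s := by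
  cases ht with
  | send s i hi ha =>
    exact ⟨s, h.start_mem (i := i) (by omega) ha,
      mem_obligations.2 ⟨i, by omega, .inr (.inl rfl)⟩⟩
  | recv s i hi ha =>
    exact ⟨s, h.start_mem (i := i) (by omega) (h.action_mem_of_sendEv (h.sendEv_mem ha)),
      mem_obligations.2 ⟨i, by omega, .inr (.inr (.inr (.inl rfl)))⟩⟩
  | act s i hi ha =>
    exact ⟨s, h.start_mem (i := i) (by omega) (h.action_mem_of_recvEv ha),
      mem_obligations.2 ⟨i + 1, hi, .inl rfl⟩⟩

/-- All actions of the run `s` have occurred. -/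
def Done (TS : Set (Transaction Sys)) (E : List (Event Ev Loc Lab PUnit.{u + 1})) (s : Ev) :
    Prop :=
  ∀ i < (runPlan TS s).length, action TS s i ∈ E

/-- No step is possible that would complete a started run. -/
def Stuck (TS : Set (Transaction Sys)) (E : List (Event Ev Loc Lab PUnit.{u + 1})) : Prop :=
  ∀ e, Step (lockingProtocol Sys) TS {a | a ∈ E} e → ∀ s, .tx s ∈ E → e ∉ obligations TS s

theorem FullConsistent.not_candidate (h : FullConsistent (lockingProtocol Sys) TS E)
    (hst : Stuck TS E) (x : Loc) (e : Event Ev Loc Lab PUnit.{u + 1}) :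
    ¬ Candidate TS x {a | a ∈ E} e := by
  intro hc
  obtain ⟨e', -, he'⟩ := hc.exists_schedules
  obtain ⟨s, hs, hob⟩ := h.exists_obligations he'.candidate.2.2.2.1
  exact hst e' (.inr he') s hs hob

theorem FullConsistent.mem_of_triggered (h : FullConsistent (lockingProtocol Sys) TS E)
    (hst : Stuck TS E) {e : Event Ev Loc Lab PUnit.{u + 1}} (ht : Triggered TS {a | a ∈ E} e)
    (hg : Guard Sys {a | a ∈ E} e) : e ∈ E := by
  by_contra he
  exact h.not_candidate hst _ e ⟨rfl, ht.not_isNIE, he, ht, hg⟩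

/-- In a stuck state, a run that is not done waits for a lock. -/
theorem FullConsistent.exists_blocked (h : FullConsistent (lockingProtocol Sys) TS E)
    (hTS : ∀ T ∈ TS, T.Secure) (hst : Stuck TS E) {s : Ev} (hs : .tx s ∈ E)
    (hd : ¬ Done TS E s) : ∃ i x l, i + 1 < (runPlan TS s).length ∧
      action TS s (i + 1) = acquire s x l ∧ action TS s (i + 1) ∉ E ∧
      ∃ t, acquire t x l ∈ E ∧ release t x l ∉ E := by
  classical
  have hex : ∃ i, i < (runPlan TS s).length ∧ action TS s i ∉ E := by
    unfold Done at hd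
    push Not at hd
    exact hd
  obtain ⟨hlt, hni⟩ := Nat.find_spec hex
  have hmin : ∀ j < Nat.find hex, action TS s j ∈ E := fun j hj => by
    by_contra hj'
    exact Nat.find_min hex hj ⟨by omega, hj'⟩
  generalize Nat.find hex = n at hlt hni hmin
  obtain ⟨T, hT⟩ := exists_runs_of_lt hlt
  cases n with
  | zero => exact absurd (hT.action_zero ▸ hs) hni
  | succ i =>
    have hsend : sendEv TS s i ∈ E :=
      h.mem_of_triggered hst (.send s i hlt (hmin i (by omega)))
        ⟨fun _ _ h => (by cases h), fun _ _ _ h => (by cases h)⟩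
    have hdelay : delayEv TS s i ∈ E := by
      by_contra hn
      exact hst _ (.inl ⟨hn, _, _, hsend⟩) s hs
        (mem_obligations.2 ⟨i, by omega, .inr (.inr (.inl rfl))⟩)
    have hrecv : recvEv TS s i ∈ E :=
      h.mem_of_triggered hst (.recv s i hlt hdelay)
        ⟨fun _ _ h => (by cases h), fun _ _ _ h => (by cases h)⟩
    have hng : ¬ Guard Sys {a | a ∈ E} (action TS s (i + 1)) := fun hg =>
      hni (h.mem_of_triggered hst (.act s i hlt hrecv) hg)
    obtain ⟨e, he, hes, hc | hc | hc⟩ := hT.action_cases hlt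
    · refine absurd ?_ hng
      rw [hc]
      refine ⟨fun r a hr ha => ?_, fun _ _ _ h => (by cases h)⟩
      obtain rfl := Event.tx.inj hr
      -- The matching send event comes earlier in the plan and has occurred, so a missing delay
      -- event could occur now, and the state would not be stuck.
      obtain ⟨haT, hbef⟩ := T.sendOf_mem e he a ha
      obtain ⟨m, n, hmn, hn, hm, hne⟩ := hT.exists_lt_of_before (hTS T hT.mem) haT he hbef
      obtain rfl := action_injective hn hlt (hne.trans hc.symm)
      by_contra hnd
      refine hst (.txDelay e) (.inl ⟨hnd, ⟨T, hT.mem, he⟩, a, ha, ?_⟩) s hs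
        (mem_obligations.2 ⟨i + 1, hlt, .inr (.inr (.inr (.inr ?_)))⟩)
      · rw [← hm]
        exact hmin m hmn
      · rw [hc]
        rfl
    · refine ⟨i, _, _, hlt, hc, hni, ?_⟩
      by_contra hn
      refine hng ?_
      rw [hc]
      refine ⟨fun _ _ h => (by cases h), fun s' x l hx t ht => ?_⟩
      rw [acquire, acquire, Event.sync.injEq] at hx
      obtain ⟨-, rfl, rfl, -⟩ := hx
      by_contra hr
      exact hn ⟨t, ht, hr⟩
    · refine absurd ?_ hng
      rw [hc]
      exact ⟨fun _ _ h => (by cases h), fun _ _ _ h => (by cases h)⟩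

theorem finite_started {Ev : Type u} {Loc : Type v} {Lab : Type w}
    (E : List (Event Ev Loc Lab PUnit.{u + 1})) :
    {s | (.tx s : Event Ev Loc Lab PUnit.{u + 1}) ∈ E}.Finite :=
  E.finite_toSet.preimage fun _ _ _ _ h => Event.tx.inj h

/-- As locks are acquired in a linear order, there is no deadlock. -/
theorem FullConsistent.done_of_stuck (h : FullConsistent (lockingProtocol Sys) TS E)
    (hTS : ∀ T ∈ TS, T.Secure) (hst : Stuck TS E) {s : Ev} (hs : .tx s ∈ E) : Done TS E s := by
  by_contra hd
  let D := {s | (.tx s : Event Ev Loc Lab PUnit.{u + 1}) ∈ E ∧ ¬ Done TS E s}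
  have hD : D.Finite := (finite_started E).subset fun _ h => h.1
  have : Finite D := hD
  have : Nonempty D := ⟨⟨s, hs, hd⟩⟩
  choose i x l hi hacq hni hbl using
    fun s : D => h.exists_blocked hTS hst (s := s) s.2.1 s.2.2
  -- The holder `t` of the lock with the largest awaited key lacks a release, so it is unfinished.
  -- The lock it awaits comes later in its plan and has a larger key.
  obtain ⟨m, hm⟩ := Finite.exists_max fun s : D => lockKey (x s) (l s)
  obtain ⟨t, hta, htr⟩ := hbl m
  obtain ⟨j, hj, hja⟩ := h.exists_action_sync hta
  obtain ⟨T, hT⟩ := exists_runs_of_lt hj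
  have hjE : action TS t (j + 1) ∈ E := hja ▸ hta
  have htd : ¬ Done TS E t := fun hdone => by
    obtain ⟨-, k, -, -, hk, -, hka⟩ := hT.exists_lock hj
    rw [hja] at hka
    have hkE := hdone k hk
    rw [hka] at hkE
    exact htr hkE
  let t' : D := ⟨t, h.start_mem hj hjE, htd⟩
  have hlt : j < i t' := by
    by_contra hle
    exact hni t' (h.action_mem (i := i t' + 1) (j := j + 1) (by omega) hj hjE)
  exact (hm t').not_gt (hT.lockKey_lt (by omega) (hi t') hja (hacq t'))

/-- Induction on the number of outstanding obligations: unless the state is stuck, some step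
discharges one. The set `S` of started runs stays fixed because no such step is a start event, so
the total of obligations does not grow. -/
theorem FullConsistent.exists_done (hTS : ∀ T ∈ TS, T.Secure) {S : Set Ev} (hS : S.Finite)
    (h : FullConsistent (lockingProtocol Sys) TS E)
    (hES : ∀ s, Sys.startOf s = s → (.tx s ∈ E ↔ s ∈ S)) :
    ∃ F, FullConsistent (lockingProtocol Sys) TS (E ++ F) ∧
      (∀ s, Sys.startOf s = s → .tx s ∉ F) ∧ ∀ s, .tx s ∈ E → Done TS (E ++ F) s := by
  have hG : (⋃ s ∈ S, obligations TS s).Finite := hS.biUnion fun s _ => finite_obligations s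
  induction hn : ((⋃ s ∈ S, obligations TS s) \ {a | a ∈ E}).ncard using Nat.strong_induction_on
    generalizing E with
  | _ n ih =>
    by_cases hst : Stuck TS E
    · exact ⟨[], by simpa using h, by simp, fun s hs => by
        simpa using h.done_of_stuck hTS hst hs⟩
    · unfold Stuck at hst
      push Not at hst
      obtain ⟨e, he, s, hs, hob⟩ := hst
      obtain ⟨hrun, hss⟩ := run_of_mem_obligations hob
      have heE : e ∉ E := he.notMem
      -- An obligation of `s` that is a start event can only be `s` itself, which has already
      -- occurred.
      have hne : ∀ s', Sys.startOf s' = s' → .tx s' ≠ e := by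
        rintro s' hs' rfl
        have hs'' : s' = s := hs'.symm.trans hrun
        exact heE (hs'' ▸ hs)
      obtain ⟨F, hF, hFs, hFd⟩ := ih _ (by
        rw [← hn]
        refine Set.ncard_lt_ncard ⟨fun a ha => ⟨ha.1, fun h' => ha.2 ?_⟩, fun hsub => ?_⟩ hG.sdiff
        · exact List.mem_append_left _ h'
        · have := hsub ⟨Set.mem_biUnion ((hES s hss).1 hs) hob, heE⟩
          exact this.2 (by simp)) (h.concat he) (fun s' hs' => by
            rw [← hES s' hs', List.mem_append, List.mem_singleton, or_iff_left (hne s' hs')]) rfl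
      refine ⟨e :: F, by simpa using hF, fun s' hs' hm => ?_, fun s' hs' => ?_⟩
      · rcases List.mem_cons.1 hm with h' | h'
        · exact hne s' hs' h'
        · exact hFs s' hs' h'
      · simpa using hFd s' (List.mem_append_left _ hs')

theorem FullConsistent.completed (h : FullConsistent (lockingProtocol Sys) TS E) {s : Ev}
    (hs : Sys.startOf s = s) (hsE : .tx s ∈ E) (hd : Done TS E s) : Completed TS E s := by
  obtain ⟨i, hi, -⟩ := h.exists_action_tx hsE
  rw [hs] at hi
  obtain ⟨T, hT⟩ := exists_runs_of_lt hi
  refine ⟨T, hT.mem, hT.start_eq, fun e he => ⟨fun heE => ?_, fun heT => ?_⟩⟩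
  · obtain ⟨j, hj, hja⟩ := h.exists_action_tx heE
    rw [he] at hj hja
    have hmem := hT.action_mem_plan hj
    rw [hja, Transaction.mem_plan, Transaction.mem_actions] at hmem
    rcases hmem with h | ⟨e', he', -, h | h | h⟩
    · rw [Event.tx.inj h]
      exact T.start_mem
    · rwa [Event.tx.inj h]
    · cases h
    · cases h
  · obtain ⟨j, hj, hja⟩ := hT.exists_action (T.tx_mem_plan heT)
    rw [← hja]
    exact hd j hj

theorem lockingProtocol_deadlockFree (hTS : ∀ T ∈ TS, T.Secure) :
    DeadlockFree (lockingProtocol Sys) TS := by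
  intro E h
  obtain ⟨F, hF, hFs, hFd⟩ := h.exists_done hTS (finite_started E) fun _ _ => Iff.rfl
  exact ⟨F, hF, hFs, fun s hs hsE =>
    hF.completed hs (List.mem_append_left _ hsE) (hFd s hsE)⟩

end Progress

end SecureScheduling

open SecureScheduling in
theorem mainTheorem2 {Ev : Type u} {Loc : Type v} {Lab : Type w} [Lattice Lab]
    (Sys : System Ev Loc Lab) :
    ∃ (Body : Type u) (p : Protocol Sys Body),
      ∀ TS : Set (Transaction Sys), (∀ T ∈ TS, T.Monotonic) →
        Serializes p TS ∧ RelaxedObservationalDeterminism p TS := by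
  refine ⟨PUnit, lockingProtocol Sys, fun TS hTS => ⟨⟨?_, fun E => ?_, ?_⟩, ?_⟩⟩
  · exact lockingProtocol_sound fun T hT => (hTS T hT).1
  · exact lockingProtocol_serializable
  · exact lockingProtocol_deadlockFree fun T hT => (hTS T hT).1
  · exact lockingProtocol_relaxedObservationalDeterminism TS
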